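/- Let $\zeta_3$ be a primitive cube root of unity and $\mathbb{Z}[\zeta_{12}]=\mathbb{Z}[\zeta_3,i]$, whose elements are written uniquely as $z=r+is$ with $r,s\in\mathbb{Z}[\zeta_3]$; here $\zeta_{12}=-i\zeta_3$. For a prime $\pi$ of $\mathbb{Z}[\zeta_3]$ not dividing $3$ let $\left[\frac{a}{\pi}\right]$ be the cubic residue character: it is $0$ if $\pi\mid a$, and otherwise it is the element of $\{1,\zeta_3,\zeta_3^2\}$ with $\left[\frac{a}{\pi}\right]\equiv a^{(N\pi-1)/3} \pmod \pi$, where $N$ is the norm from $\mathbb{Q}(\zeta_3)$ to $\mathbb{Q}$. Put $\left[\frac{a}{1-\zeta_3}\right]=1$ and $\left[\frac{a}{\mu}\right]=1$ for units $\mu$, and extend $\left[\frac{a}{b}\right]$ multiplicatively to all non-zero $b\in\mathbb{Z}[\zeta_3]$. Call $z\in\mathbb{Z}[\zeta_{12}]$ primary if $z\equiv\pm1\pmod 3$, and for a primary $z=r+is$ (so that $r\neq0$) define the cubic spin $[z]:=\left[\frac{s}{r}\right]$. Let $$\epsilon_0:=\frac{1+\sqrt3}{1-i}=1+\zeta_3-i\zeta_3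 .$$ 1. We have $-i\epsilon_0^6\equiv1\pmod 3$. Moreover $k=6$ is the smallest positive exponent such that $\epsilon_0^k\equiv\zeta_{12}^\ell\pmod 3$ for some integer $\ell$, and as a set $$(\mathbb{Z}[\zeta_{12}]/3\mathbb{Z}[\zeta_{12}])^\times=\{\zeta_{12}^\ell\epsilon_0^k:\ \ell\in\mathbb{Z},\ k\in\{0,1,\dots,5\}\}.$$ 2. The primary units of $\mathbb{Z}[\zeta_{12}]$ are exactly $\pm(i\epsilon_0^6)^k$, $k\in\mathbb{Z}$, and $[i\epsilon_0^6]=[-i\epsilon_0^6]=1$. 3. If $z$ and $z'$ are primary associates, then $[z]=[z']$. 4. Hence the cubic spin is well defined on ideals: an ideal $\mathfrak{a}$ of $\mathbb{Z}[\zeta_{12}]$ has a primary generator if and only if it is coprime to $3$, and there is a unique function $\mathfrak{a}\mapsto[\mathfrak{a}]$ on the ideals of $\mathbb{Z}[\zeta_{12}]$ such that $[\mathfrak{a}]=[z]$ for every primary generator $z$ of $\mathfrak{a}$, and $[\mathfrak{a}]=0$ if $\mathfrak{a}$ has no primary generator $z=r+is$ with $r,s$ coprime in $\mathbb{Z}[\zeta_3]$.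 -/

import Mathlib

namespace CubicSpin

open scoped QuadraticAlgebra

/-- The Eisenstein integers `ℤ[ζ₃]`: elements `⟨a, b⟩ = a + b ζ₃` with `ζ₃ ^ 2 = -1 - ζ₃`. -/
abbrev Eis : Type := QuadraticAlgebra ℤ (-1) (-1)

/-- The ring `ℤ[ζ₁₂] = ℤ[ζ₃][i]`: elements `⟨r, s⟩ = r + i s` with `r, s ∈ ℤ[ζ₃]`
and `i ^ 2 = -1`. -/
abbrev Cyc12 : Type := QuadraticAlgebra Eis (-1) 0

namespace Eis

/-- The primitive cube root of unity `ζ₃`. -/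
def zeta3 : Eis := ⟨0, 1⟩

theorem zeta3_sq : zeta3 ^ 2 + zeta3 + 1 = 0 := by
  rw [pow_two]; ext <;> simp [zeta3]

/-- `N₃(a + b ζ₃) = a² - a b + b²`. -/
theorem norm_eq (z : Eis) : z.norm = z.re ^ 2 - z.re * z.im + z.im ^ 2 := by
  rw [QuadraticAlgebra.norm_def]; ring

theorem norm_nonneg (z : Eis) : 0 ≤ z.norm := by
  rw [norm_eq]; nlinarith [sq_nonneg (z.re - z.im), sq_nonneg z.re, sq_nonneg z.im]

theorem norm_eq_zero_iff (z : Eis) : z.norm = 0 ↔ z = 0 := by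
  constructor
  · intro h
    rw [norm_eq] at h
    have h1 : z.re = 0 := by
      have : z.re ^ 2 = 0 := by
        nlinarith [sq_nonneg (z.re - z.im), sq_nonneg z.re, sq_nonneg z.im]
      simpa using this
    have h2 : z.im = 0 := by
      have : z.im ^ 2 = 0 := by
        nlinarith [sq_nonneg (z.re - z.im), sq_nonneg z.re, sq_nonneg z.im]
      simpa using this
    ext <;> simp [h1, h2]
  · rintro rfl; simp

instance : IsDomain Eis :=
  haveI : NoZeroDivisors Eis := ⟨fun {a b} h => by
    have h1 : a.norm * b.norm = 0 := by rw [← map_mul, h, QuadraticAlgebra.norm_zero]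
    rcases mul_eq_zero.1 h1 with h2 | h2
    · exact Or.inl ((norm_eq_zero_iff a).1 h2)
    · exact Or.inr ((norm_eq_zero_iff b).1 h2)⟩
  NoZeroDivisors.to_isDomain _

theorem norm_pos {z : Eis} (h : z ≠ 0) : 0 < z.norm :=
  lt_of_le_of_ne (norm_nonneg z) fun h' => h ((norm_eq_zero_iff z).1 h'.symm)

/-- Division with remainder in `ℤ[ζ₃]` with respect to the norm. -/
theorem exists_norm_sub_mul_lt (x y : Eis) (hy : y ≠ 0) :
    ∃ q : Eis, (x - y * q).norm < y.norm := by
  have hn : 0 < y.norm := norm_pos hy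
  set n := y.norm with hn'
  set t : Eis := x * star y with ht
  have key : ∀ m : ℤ, ∃ k : ℤ, 4 * (m - n * k) ^ 2 ≤ n ^ 2 := fun m => by
    refine ⟨(2 * m + n) / (2 * n), ?_⟩
    have h1 := Int.emod_add_mul_ediv (2 * m + n) (2 * n)
    have h2 := Int.emod_nonneg (2 * m + n) (show (2 * n) ≠ 0 by omega)
    have h3 := Int.emod_lt_of_pos (2 * m + n) (show 0 < 2 * n by omega)
    nlinarith
  obtain ⟨k, hk⟩ := key t.re
  obtain ⟨l, hl⟩ := key t.im
  refine ⟨⟨k, l⟩, ?_⟩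
  have hstar : y * star y = algebraMap ℤ Eis n := (QuadraticAlgebra.algebraMap_norm_eq_mul_star y).symm
  have e1 : (x - y * ⟨k, l⟩) * star y = ⟨t.re - n * k, t.im - n * l⟩ := by
    have : (x - y * ⟨k, l⟩) * star y = t - (y * star y) * ⟨k, l⟩ := by rw [ht]; ring
    rw [this, hstar]
    ext <;> simp
  have e2 : (x - y * ⟨k, l⟩).norm * n
      = (t.re - n * k) ^ 2 - (t.re - n * k) * (t.im - n * l) + (t.im - n * l) ^ 2 := by
    have h : (x - y * ⟨k, l⟩).norm * (star y).norm = (⟨t.re - n * k, t.im - n * l⟩ : Eis).norm := by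
      rw [← map_mul, e1]
    rwa [QuadraticAlgebra.norm_star, norm_eq ⟨t.re - n * k, t.im - n * l⟩] at h
  have e3 : (x - y * ⟨k, l⟩).norm * n < n * n := by
    rw [e2]
    nlinarith [sq_nonneg ((t.re - n * k) + (t.im - n * l)), mul_pos hn hn]
  exact lt_of_mul_lt_mul_right e3 hn.le

/-- `ℤ[ζ₃]` is a principal ideal domain, hence a unique factorization domain. -/
instance : IsPrincipalIdealRing Eis := ⟨fun I => by
  by_cases hI : I = ⊥
  · subst hI; infer_instance
  obtain ⟨y₀, hy₀, hy₀'⟩ := (Submodule.ne_bot_iff I).1 hI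
  obtain ⟨y, ⟨hyI, hy0⟩, hmin⟩ := WellFounded.has_min
    (measure fun z : Eis => z.norm.toNat).wf {z | z ∈ I ∧ z ≠ 0} ⟨y₀, hy₀, hy₀'⟩
  refine ⟨⟨y, le_antisymm (fun x hx => ?_) ?_⟩⟩
  · obtain ⟨q, hq⟩ := exists_norm_sub_mul_lt x y hy0
    have hmem : x - y * q ∈ I := I.sub_mem hx (I.mul_mem_right q hyI)
    have h0 : x - y * q = 0 := by
      by_contra h
      refine hmin _ ⟨hmem, h⟩ ?_
      change (x - y * q).norm.toNat < y.norm.toNat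
      have := norm_nonneg (x - y * q)
      omega
    exact Ideal.mem_span_singleton'.2 ⟨q, by rw [mul_comm]; exact (sub_eq_zero.1 h0).symm⟩
  · exact (Ideal.span_singleton_le_iff_mem I).2 hyI⟩

open Classical in
/-- The cubic residue character `[a / π]` for a prime `π` of `ℤ[ζ₃]`. It is `1` if `π` is an
associate of the ramified prime `1 - ζ₃` (that is, `π ∣ 3`). For any other prime `π` it is `0` if
`π ∣ a`, and otherwise it is the cube root of unity `ζ₃ ^ k` with
`a ^ ((N π - 1) / 3) ≡ ζ₃ ^ k (mod π)`; such a `k` exists and is unique modulo `3`, as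
`a ^ (N π - 1) ≡ 1 (mod π)` and `1, ζ₃, ζ₃ ^ 2` are distinct modulo `π`. -/
noncomputable def residuePrime (a p : Eis) : Eis :=
  if p ∣ 3 then 1
  else if p ∣ a then 0
  else if p ∣ a ^ ((p.norm.toNat - 1) / 3) - 1 then 1
  else if p ∣ a ^ ((p.norm.toNat - 1) / 3) - zeta3 then zeta3
  else zeta3 ^ 2

/-- The cubic residue character `[a / b]` for `b ≠ 0`: the product of `[a / π]` over the prime
factors `π` of `b`, with multiplicity (`[a / π]` depends only on `a` and the ideal `(π)`).
In particular it is `1` if `b` is a unit. -/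
noncomputable def residue (a b : Eis) : Eis :=
  ((UniqueFactorizationMonoid.factors b).map (residuePrime a)).prod

end Eis

namespace Cyc12

/-- The unit `i` of `ℤ[ζ₁₂]`. -/
def I : Cyc12ˣ where
  val := ⟨0, 1⟩
  inv := ⟨0, -1⟩
  val_inv := by ext <;> simp
  inv_val := by ext <;> simp

/-- The unit `ζ₁₂ = -i ζ₃` of `ℤ[ζ₁₂]`, which is `exp (2 π i / 12)` when `ζ₃ = exp (2 π i / 3)`;
its inverse is `i ζ₃ ^ 2 = i (-1 - ζ₃)`. -/
def zeta12 : Cyc12ˣ where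
  val := ⟨0, ⟨0, -1⟩⟩
  inv := ⟨0, ⟨-1, -1⟩⟩
  val_inv := by ext <;> simp
  inv_val := by ext <;> simp

/-- The fundamental unit `ε₀ = (1 + √3) / (1 - i) = 1 + ζ₃ - i ζ₃`;
its inverse is `-(1 + ζ₃) - i ζ₃`. -/
def eps0 : Cyc12ˣ where
  val := ⟨⟨1, 1⟩, ⟨0, -1⟩⟩
  inv := ⟨⟨-1, -1⟩, ⟨0, -1⟩⟩
  val_inv := by ext <;> simp
  inv_val := by ext <;> simp

theorem zeta12_primitive : IsPrimitiveRoot zeta12 12 := by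
  have h2 : zeta12 ^ 2 = ⟨⟨⟨1, 1⟩, 0⟩, ⟨⟨0, -1⟩, 0⟩, by ext <;> simp, by ext <;> simp⟩ := by
    rw [pow_two]; ext <;> simp [zeta12]
  have h4 : zeta12 ^ 4 = ⟨⟨⟨0, 1⟩, 0⟩, ⟨⟨-1, -1⟩, 0⟩, by ext <;> simp, by ext <;> simp⟩ := by
    rw [show 4 = 2 * 2 from rfl, pow_mul, h2, pow_two]; ext <;> simp
  have h6 : zeta12 ^ 6 = -1 := by
    rw [show 6 = 4 + 2 from rfl, pow_add, h4, h2]; ext <;> simp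
  rw [IsPrimitiveRoot.iff_orderOf]
  refine orderOf_eq_of_pow_and_pow_div_prime (by norm_num) ?_ ?_
  · rw [show 12 = 6 * 2 from rfl, pow_mul, h6]; simp
  · intro p hp hd
    have hp' : p = 2 ∨ p = 3 := by
      have : p ∣ 2 ^ 2 * 3 := hd
      rcases (Nat.Prime.dvd_mul hp).1 this with h | h
      · exact Or.inl ((Nat.prime_dvd_prime_iff_eq hp Nat.prime_two).1 (hp.dvd_of_dvd_pow h))
      · exact Or.inr ((Nat.prime_dvd_prime_iff_eq hp Nat.prime_three).1 h)
    rcases hp' with rfl | rfl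
    · rw [show 12 / 2 = 6 from rfl, h6]
      intro h
      have := congrArg (fun u : Cyc12ˣ => (u : Cyc12).re.re) h
      norm_num at this
    · rw [show 12 / 3 = 4 from rfl, h4]
      intro h
      have := congrArg (fun u : Cyc12ˣ => (u : Cyc12).re.re) h
      norm_num at this

/-- With `√3 = -i (1 + 2 ζ₃)` one has `(1 - i) ε₀ = 1 + √3`. -/
theorem eps0_eq : ∃ w : Cyc12, w ^ 2 = 3 ∧ (1 - (I : Cyc12)) * eps0 = 1 + w := by
  refine ⟨⟨0, ⟨-1, -2⟩⟩, ?_, ?_⟩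
  · rw [pow_two]; ext <;> simp [QuadraticAlgebra.re_ofNat, QuadraticAlgebra.im_ofNat]
  · ext <;> simp [I, eps0]

/-- `z` is primary if `z ≡ ± 1 (mod 3)`. -/
def IsPrimary (z : Cyc12) : Prop := 3 ∣ z - 1 ∨ 3 ∣ z + 1

/-- `z = r + i s` is primitive if `r` and `s` are coprime in `ℤ[ζ₃]`. -/
def IsPrimitive (z : Cyc12) : Prop := IsCoprime z.re z.im

/-- The cubic spin `[z] = [s / r]` of `z = r + i s` (with value in `{0, 1, ζ₃, ζ₃ ^ 2}`). -/
noncomputable def spin (z : Cyc12) : Eis := Eis.residue z.im z.re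

end Cyc12

end CubicSpin

namespace CubicSpin

open scoped QuadraticAlgebra

namespace Eis

theorem zeta3_cube : zeta3 ^ 3 = 1 := by
  have := zeta3_sq
  linear_combination (zeta3 - 1) * this

theorem zeta3_pow_mod (n : ℕ) : zeta3 ^ n = zeta3 ^ (n % 3) := by
  conv_lhs => rw [← Nat.div_add_mod n 3, pow_add, pow_mul, zeta3_cube, one_pow, one_mul]

theorem zeta3_sq_eq : zeta3 ^ 2 = ⟨-1, -1⟩ := by
  rw [pow_two]; ext <;> simp [zeta3]

theorem mul_star_self (z : Eis) : z * star z = (z.norm : Eis) :=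
  (QuadraticAlgebra.algebraMap_norm_eq_mul_star z).symm

theorem isUnit_iff_norm (z : Eis) : IsUnit z ↔ z.norm = 1 := by
  rw [QuadraticAlgebra.isUnit_iff_norm_isUnit, Int.isUnit_iff]
  have := norm_nonneg z
  omega

theorem dvd_norm (z : Eis) : z ∣ (z.norm : Eis) := ⟨star z, (mul_star_self z).symm⟩

theorem intCast_dvd_iff (n : ℤ) (z : Eis) : (n : Eis) ∣ z ↔ n ∣ z.re ∧ n ∣ z.im :=
  QuadraticAlgebra.algebraMap_dvd_iff

theorem ofNat_dvd_iff (n : ℕ) [n.AtLeastTwo] (z : Eis) :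
    (OfNat.ofNat n : Eis) ∣ z ↔ (OfNat.ofNat n : ℤ) ∣ z.re ∧ (OfNat.ofNat n : ℤ) ∣ z.im := by
  rw [← intCast_dvd_iff]; norm_cast

/-- The prime `1 - ζ₃` above `3`. -/
def lam : Eis := 1 - zeta3

theorem lam_norm : lam.norm = 3 := by
  rw [norm_eq]; simp [lam, zeta3]

theorem three_eq : (3 : Eis) = -(zeta3 ^ 2 * lam ^ 2) := by
  rw [lam]; linear_combination (zeta3 ^ 2 - 3 * zeta3 + 3) * zeta3_sq

theorem lam_dvd_three : lam ∣ 3 :=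
  ⟨-(zeta3 ^ 2 * lam), by rw [three_eq]; ring⟩

theorem lam_dvd_iff (z : Eis) : lam ∣ z ↔ (3 : ℤ) ∣ z.re + z.im := by
  constructor
  · rintro ⟨c, rfl⟩
    simp only [lam, zeta3, QuadraticAlgebra.re_mul, QuadraticAlgebra.im_mul,
      QuadraticAlgebra.re_sub, QuadraticAlgebra.im_sub, QuadraticAlgebra.re_one,
      QuadraticAlgebra.im_one]
    exact ⟨c.im, by ring⟩
  · rintro ⟨k, hk⟩
    refine ⟨⟨z.re - k, k⟩, ?_⟩
    ext
    · simp [lam, zeta3]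
    · simp [lam, zeta3]; linarith

theorem prime_lam : Prime lam := by
  rw [← irreducible_iff_prime]
  constructor
  · rw [isUnit_iff_norm, lam_norm]; norm_num
  · intro a b h
    have h1 : a.norm * b.norm = 3 := by rw [← map_mul, ← h, lam_norm]
    rw [isUnit_iff_norm, isUnit_iff_norm]
    have ha := norm_nonneg a
    have hb := norm_nonneg b
    have : a.norm ∣ 3 := ⟨_, h1.symm⟩
    have h3 : a.norm ≤ 3 := Int.le_of_dvd (by norm_num) this
    interval_cases h : a.norm <;> omega

theorem associated_lam_of_dvd_three {p : Eis} (hp : Prime p) (h : p ∣ 3) : Associated p lam := by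
  rw [three_eq, dvd_neg, ← mul_pow] at h
  have h1 := hp.dvd_of_dvd_pow h
  have hz : IsUnit zeta3 := IsUnit.of_pow_eq_one zeta3_cube (by norm_num)
  exact hp.associated_of_dvd prime_lam ((hz.dvd_mul_left).1 h1)

theorem dvd_three_iff_lam_dvd {p : Eis} (hp : Prime p) : p ∣ 3 ↔ lam ∣ p := by
  constructor
  · exact fun h => (associated_lam_of_dvd_three hp h).symm.dvd
  · exact fun h => (prime_lam.associated_of_dvd hp h).symm.dvd.trans lam_dvd_three

theorem norm_emod_three {z : Eis} (h : ¬ lam ∣ z) : z.norm % 3 = 1 := by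
  rw [lam_dvd_iff] at h
  have h1 : z.norm = (z.re + z.im) ^ 2 - 3 * (z.re * z.im) := by rw [norm_eq]; ring
  rw [h1, Int.sub_mul_emod_self_left]
  have h2 : (z.re + z.im) % 3 = 1 ∨ (z.re + z.im) % 3 = 2 := by omega
  rcases h2 with h2 | h2 <;> rw [pow_two, Int.mul_emod, h2] <;> rfl

theorem three_dvd_toNat_norm_sub_one {z : Eis} (h : ¬ lam ∣ z) : 3 ∣ z.norm.toNat - 1 := by
  have := norm_emod_three h
  omega

theorem norm_prime_gt {p : Eis} (hp : Prime p) : 1 < p.norm := by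
  have h0 := norm_pos hp.ne_zero
  have h1 : p.norm ≠ 1 := fun h => hp.not_isUnit ((isUnit_iff_norm p).2 h)
  omega

theorem pow_card_sub_one_pos {p : Eis} (hp : Prime p) (h3 : ¬ p ∣ 3) :
    0 < (p.norm.toNat - 1) / 3 := by
  have h1 := norm_emod_three (fun h => h3 ((dvd_three_iff_lam_dvd hp).2 h))
  have := norm_prime_gt hp
  omega

theorem natCard_quotient (p : Eis) : Nat.card (Eis ⧸ Ideal.span {p}) = p.norm.toNat := by
  have h1 := Ideal.absNorm_span_singleton p
  have h2 : Algebra.norm ℤ p = p.norm := by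
    rw [Algebra.norm_apply]
    exact QuadraticAlgebra.det_toLinearMap_eq_norm p
  rw [h2] at h1
  have := norm_nonneg p
  change Ideal.absNorm (Ideal.span {p}) = _
  omega

theorem isMaximal_span {p : Eis} (hp : Prime p) : (Ideal.span {p}).IsMaximal :=
  ((Ideal.span_singleton_prime hp.ne_zero).2 hp).isMaximal
    (by simpa using hp.ne_zero)

theorem finite_quotient {p : Eis} (hp : p ≠ 0) : Finite (Eis ⧸ Ideal.span {p}) := by
  apply Nat.finite_of_card_ne_zero
  rw [natCard_quotient]
  have := norm_pos hp
  omega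

theorem mk_eq_zero_iff (p a : Eis) : Ideal.Quotient.mk (Ideal.span {p}) a = 0 ↔ p ∣ a := by
  rw [Ideal.Quotient.eq_zero_iff_mem, Ideal.mem_span_singleton]

theorem mk_eq_mk_iff (p a b : Eis) :
    Ideal.Quotient.mk (Ideal.span {p}) a = Ideal.Quotient.mk (Ideal.span {p}) b ↔ p ∣ a - b := by
  rw [← mk_eq_zero_iff, map_sub, sub_eq_zero]

/-- Fermat's little theorem in `ℤ[ζ₃]`. -/
theorem dvd_pow_norm_sub_one {p a : Eis} (hp : Prime p) (ha : ¬ p ∣ a) :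
    p ∣ a ^ (p.norm.toNat - 1) - 1 := by
  have := isMaximal_span hp
  let := Ideal.Quotient.field (Ideal.span {p})
  have := finite_quotient hp.ne_zero
  have := Fintype.ofFinite (Eis ⧸ Ideal.span {p})
  rw [← mk_eq_mk_iff, map_pow, map_one, ← natCard_quotient, Nat.card_eq_fintype_card]
  exact FiniteField.pow_card_sub_one_eq_one _ (fun h => ha ((mk_eq_zero_iff p a).1 h))

/-- `x` is zero or a cube root of unity. -/
def IsCubicValue (x : Eis) : Prop := x = 0 ∨ x = 1 ∨ x = zeta3 ∨ x = zeta3 ^ 2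

theorem isCubicValue_iff {x : Eis} : IsCubicValue x ↔ x ^ 4 = x := by
  constructor
  · rintro (rfl | rfl | rfl | rfl)
    · simp
    · simp
    · linear_combination zeta3 * zeta3_cube
    · linear_combination zeta3 ^ 2 * (zeta3 ^ 3 + 1) * zeta3_cube
  · intro h
    have h1 : x * ((x - 1) * ((x - zeta3) * (x - zeta3 ^ 2))) = 0 := by
      linear_combination h - (x ^ 3 - x ^ 2 * (1 - zeta3 + 1 - 1 + zeta3) ) * zeta3_sq
        + x * (x - 1) * zeta3_cube
    simpa [IsCubicValue, sub_eq_zero] using h1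

theorem IsCubicValue.mul {x y : Eis} (hx : IsCubicValue x) (hy : IsCubicValue y) :
    IsCubicValue (x * y) := by
  rw [isCubicValue_iff] at *
  rw [mul_pow, hx, hy]

theorem isCubicValue_one : IsCubicValue 1 := Or.inr (Or.inl rfl)

theorem IsCubicValue.star {x : Eis} (hx : IsCubicValue x) : IsCubicValue (star x) := by
  rw [isCubicValue_iff] at *
  rw [← star_pow, hx]

theorem IsCubicValue.pow_three {x : Eis} (hx : IsCubicValue x) (h0 : x ≠ 0) : x ^ 3 = 1 := by
  rw [isCubicValue_iff] at hx
  exact mul_left_cancel₀ h0 (by linear_combination hx)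

theorem IsCubicValue.eq_one_of_star_eq {x : Eis} (hx : IsCubicValue x) (h0 : x ≠ 0)
    (h : Star.star x = x) : x = 1 := by
  rcases hx with rfl | rfl | rfl | rfl
  · exact absurd rfl h0
  · rfl
  · have := congrArg QuadraticAlgebra.im h
    norm_num [zeta3] at this
  · rw [zeta3_sq_eq] at h
    have := congrArg QuadraticAlgebra.im h
    norm_num at this

theorem IsCubicValue.eq_one_of_sq_eq_one {x : Eis} (hx : IsCubicValue x) (h : x ^ 2 = 1) :
    x = 1 := by
  rw [isCubicValue_iff] at hx
  linear_combination -hx + (x ^ 2 + 1) * h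

theorem IsCubicValue.eq_of_sq_eq_sq {x y : Eis} (hx : IsCubicValue x) (hy : IsCubicValue y)
    (h : x ^ 2 = y ^ 2) : x = y := by
  rw [isCubicValue_iff] at hx hy
  linear_combination -hx + hy + (x ^ 2 + y ^ 2) * h

theorem IsCubicValue.eq_of_dvd_sub {x y p : Eis} (hx : IsCubicValue x) (hy : IsCubicValue y)
    (h3 : ¬ p ∣ 3) (h : p ∣ x - y) : x = y := by
  by_contra hxy
  apply h3
  refine (h.trans (dvd_norm _)).trans ?_
  have h1 : (x - y).norm ∣ 3 := by
    rw [IsCubicValue, zeta3_sq_eq] at hx hy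
    rw [norm_eq]
    rcases hx with rfl | rfl | rfl | rfl <;> rcases hy with rfl | rfl | rfl | rfl <;>
      first
      | exact absurd rfl hxy
      | (simp [zeta3])
  exact_mod_cast (Int.cast_dvd_cast (α := Eis) _ _ h1)

theorem isCubicValue_residuePrime (a p : Eis) : IsCubicValue (residuePrime a p) := by
  unfold residuePrime IsCubicValue
  split_ifs <;> simp

theorem residuePrime_of_dvd_three {a p : Eis} (h : p ∣ 3) : residuePrime a p = 1 := by
  simp [residuePrime, h]

theorem dvd_pow_sub_residuePrime {p : Eis} (hp : Prime p) (h3 : ¬ p ∣ 3) (a : Eis) :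
    p ∣ a ^ ((p.norm.toNat - 1) / 3) - residuePrime a p := by
  unfold residuePrime
  rw [if_neg h3]
  split_ifs with h h1 h2
  · rw [sub_zero]
    exact dvd_pow h (pow_card_sub_one_pos hp h3).ne'
  · exact h1
  · exact h2
  · have hf := dvd_pow_norm_sub_one hp h
    obtain ⟨k, hk⟩ := three_dvd_toNat_norm_sub_one
      (fun h => h3 ((dvd_three_iff_lam_dvd hp).2 h))
    rw [hk, Nat.mul_div_cancel_left k (by norm_num)] at h1 h2 ⊢
    rw [hk, mul_comm, pow_mul] at hf
    have e : (a ^ k) ^ 3 - 1 = (a ^ k - 1) * ((a ^ k - zeta3) * (a ^ k - zeta3 ^ 2)) := by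
      linear_combination (a ^ k * a ^ k - a ^ k * 1) * zeta3_sq + (1 - a ^ k) * zeta3_cube
    rw [e] at hf
    exact ((hp.dvd_or_dvd hf).resolve_left h1 |> hp.dvd_or_dvd).resolve_left h2

theorem residuePrime_eq_of_dvd {p : Eis} (hp : Prime p) (h3 : ¬ p ∣ 3) {a x : Eis}
    (hx : IsCubicValue x) (h : p ∣ a ^ ((p.norm.toNat - 1) / 3) - x) : residuePrime a p = x := by
  refine (isCubicValue_residuePrime a p).eq_of_dvd_sub hx h3 ?_
  have := dvd_sub h (dvd_pow_sub_residuePrime hp h3 a)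
  convert this using 1; ring

theorem residuePrime_mul {p : Eis} (hp : Prime p) (a b : Eis) :
    residuePrime (a * b) p = residuePrime a p * residuePrime b p := by
  by_cases h3 : p ∣ 3
  · simp [residuePrime_of_dvd_three h3]
  refine residuePrime_eq_of_dvd hp h3
    ((isCubicValue_residuePrime a p).mul (isCubicValue_residuePrime b p)) ?_
  obtain ⟨c, hc⟩ := dvd_pow_sub_residuePrime hp h3 a
  obtain ⟨d, hd⟩ := dvd_pow_sub_residuePrime hp h3 b
  rw [mul_pow]
  exact ⟨b ^ ((p.norm.toNat - 1) / 3) * c + residuePrime a p * d, by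
    linear_combination b ^ ((p.norm.toNat - 1) / 3) * hc + residuePrime a p * hd⟩

theorem residuePrime_congr {p : Eis} (hp : Prime p) {a b : Eis} (h : p ∣ a - b) :
    residuePrime a p = residuePrime b p := by
  by_cases h3 : p ∣ 3
  · simp [residuePrime_of_dvd_three h3]
  refine residuePrime_eq_of_dvd hp h3 (isCubicValue_residuePrime b p) ?_
  have h1 := dvd_add (h.trans (sub_dvd_pow_sub_pow a b ((p.norm.toNat - 1) / 3)))
    (dvd_pow_sub_residuePrime hp h3 b)
  convert h1 using 1; ring

theorem residuePrime_eq_zero_iff (p a : Eis) :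
    residuePrime a p = 0 ↔ ¬ p ∣ 3 ∧ p ∣ a := by
  unfold residuePrime
  have hz : zeta3 ≠ 0 := by
    intro h; have := congrArg QuadraticAlgebra.im h; simp [zeta3] at this
  split_ifs <;> simp_all

theorem norm_eq_of_associated {p q : Eis} (h : Associated p q) : p.norm = q.norm := by
  obtain ⟨u, rfl⟩ := h
  rw [map_mul, (isUnit_iff_norm _).1 u.isUnit, mul_one]

theorem residuePrime_associated {p q : Eis} (h : Associated p q) (a : Eis) :
    residuePrime a p = residuePrime a q := by
  have e : ∀ c, p ∣ c ↔ q ∣ c := fun c => h.dvd_iff_dvd_left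
  unfold residuePrime
  rw [norm_eq_of_associated h]
  classical
  exact ite_congr (propext (e _)) (fun _ => rfl) fun _ => ite_congr (propext (e _)) (fun _ => rfl)
    fun _ => ite_congr (propext (e _)) (fun _ => rfl) fun _ => ite_congr (propext (e _))
    (fun _ => rfl) fun _ => rfl

theorem prime_star {p : Eis} (hp : Prime p) : Prime (star p) :=
  (MulEquiv.prime_iff (starMulAut : Eis ≃* Eis)).2 hp

theorem star_dvd_star {a b : Eis} : star a ∣ star b ↔ a ∣ b :=
  map_dvd_iff (starMulAut : Eis ≃* Eis)

theorem residuePrime_star {p : Eis} (hp : Prime p) (a : Eis) :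
    residuePrime (star a) (star p) = star (residuePrime a p) := by
  have e3 : star (3 : Eis) = 3 := star_ofNat 3
  by_cases h3 : p ∣ 3
  · rw [residuePrime_of_dvd_three h3, residuePrime_of_dvd_three, star_one]
    rwa [← e3, star_dvd_star]
  refine residuePrime_eq_of_dvd (prime_star hp) (by rwa [← e3, star_dvd_star])
    (isCubicValue_residuePrime a p).star ?_
  rw [QuadraticAlgebra.norm_star, ← star_pow, ← star_sub, star_dvd_star]
  exact dvd_pow_sub_residuePrime hp h3 a

/-! ### The symbol `[a / b]` -/

open UniqueFactorizationMonoid in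
theorem residue_mul_right (a : Eis) {b c : Eis} (hb : b ≠ 0) (hc : c ≠ 0) :
    residue a (b * c) = residue a b * residue a c := by
  have h := factors_mul hb hc
  unfold residue
  rw [← Multiset.prod_add, ← Multiset.map_add]
  have h2 : Multiset.Rel Eq ((factors (b * c)).map (residuePrime a))
      ((factors b + factors c).map (residuePrime a)) := by
    rw [Multiset.rel_map]
    exact h.mono fun x _ y _ hxy => residuePrime_associated hxy a
  rw [Multiset.rel_eq.1 h2]

theorem residue_unit (a : Eis) {b : Eis} (hb : IsUnit b) : residue a b = 1 := by
  unfold residue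
  rw [(UniqueFactorizationMonoid.factors_of_isUnit hb)]
  simp

theorem residue_associated (a : Eis) {b c : Eis} (h : Associated b c) :
    residue a b = residue a c := by
  obtain ⟨u, rfl⟩ := h
  by_cases hb : b = 0
  · simp [hb]
  rw [residue_mul_right a hb u.ne_zero, residue_unit a u.isUnit, mul_one]

theorem residue_prime (a : Eis) {p : Eis} (hp : Prime p) : residue a p = residuePrime a p := by
  obtain ⟨q, hq, h⟩ := UniqueFactorizationMonoid.factors_eq_singleton_of_irreducible hp.irreducible
  unfold residue
  rw [h, Multiset.map_singleton, Multiset.prod_singleton, residuePrime_associated hq]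

/-- Induction on the prime factorization of the denominator. -/
theorem induction_prime {P : ∀ b : Eis, b ≠ 0 → Prop} (h1 : ∀ u (hu : IsUnit u), P u hu.ne_zero)
    (h2 : ∀ p b (hp : Prime p) (hb : b ≠ 0), P b hb → P (p * b) (mul_ne_zero hp.ne_zero hb))
    (b : Eis) (hb : b ≠ 0) : P b hb := by
  induction b using UniqueFactorizationMonoid.induction_on_prime with
  | h₁ => exact absurd rfl hb
  | h₂ u hu => exact h1 u hu
  | h₃ a p ha hp ih => exact h2 p a hp ha (ih ha)

theorem isCubicValue_residue (a : Eis) {b : Eis} (hb : b ≠ 0) : IsCubicValue (residue a b) := by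
  induction b, hb using induction_prime with
  | h1 u hu => rw [residue_unit a hu]; exact isCubicValue_one
  | h2 p b hp hb ih =>
    rw [residue_mul_right a hp.ne_zero hb, residue_prime a hp]
    exact (isCubicValue_residuePrime a p).mul ih

theorem residue_mul_left (a a' : Eis) {b : Eis} (hb : b ≠ 0) :
    residue (a * a') b = residue a b * residue a' b := by
  induction b, hb using induction_prime with
  | h1 u hu => simp [residue_unit _ hu]
  | h2 p b hp hb ih =>
    simp only [residue_mul_right _ hp.ne_zero hb, residue_prime _ hp, ih, residuePrime_mul hp]
    ring

theorem residue_congr {a a' b : Eis} (hb : b ≠ 0) (h : b ∣ a - a') :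
    residue a b = residue a' b := by
  induction b, hb using induction_prime with
  | h1 u hu => simp [residue_unit _ hu]
  | h2 p b hp hb ih =>
    simp only [residue_mul_right _ hp.ne_zero hb, residue_prime _ hp,
      ih ((dvd_mul_left b p).trans h), residuePrime_congr hp ((dvd_mul_right p b).trans h)]

theorem residue_eq_zero_iff (a : Eis) {b : Eis} (hb : b ≠ 0) :
    residue a b = 0 ↔ ∃ p, Prime p ∧ ¬ p ∣ 3 ∧ p ∣ b ∧ p ∣ a := by
  induction b, hb using induction_prime with
  | h1 u hu =>
    rw [residue_unit _ hu]
    refine ⟨fun h => absurd h one_ne_zero, ?_⟩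
    rintro ⟨p, hp, -, h, -⟩
    exact absurd (isUnit_of_dvd_unit h hu) hp.not_isUnit
  | h2 p b hp hb ih =>
    rw [residue_mul_right _ hp.ne_zero hb, residue_prime _ hp, mul_eq_zero, ih,
      residuePrime_eq_zero_iff]
    constructor
    · rintro (⟨h, h'⟩ | ⟨q, hq, h3, h, h'⟩)
      · exact ⟨p, hp, h, dvd_mul_right p b, h'⟩
      · exact ⟨q, hq, h3, h.mul_left p, h'⟩
    · rintro ⟨q, hq, h3, h, h'⟩
      rcases hq.dvd_or_dvd h with h | h
      · have := hq.associated_of_dvd hp h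
        exact Or.inl ⟨by rwa [← this.dvd_iff_dvd_left], by rwa [← this.dvd_iff_dvd_left]⟩
      · exact Or.inr ⟨q, hq, h3, h, h'⟩

theorem residue_ne_zero_of_isCoprime {a b : Eis} (hb : b ≠ 0) (h : IsCoprime a b) :
    residue a b ≠ 0 := by
  rw [Ne, residue_eq_zero_iff a hb]
  rintro ⟨p, hp, -, hpb, hpa⟩
  exact hp.not_isUnit (h.isUnit_of_dvd' hpa hpb)

theorem residue_star (a : Eis) {b : Eis} (hb : b ≠ 0) :
    residue (star a) (star b) = star (residue a b) := by
  induction b, hb using induction_prime with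
  | h1 u hu => rw [residue_unit _ hu, residue_unit _ hu.star, star_one]
  | h2 p b hp hb ih =>
    have hb' : star b ≠ 0 := by simpa using hb
    rw [star_mul', residue_mul_right _ (prime_star hp).ne_zero hb', ih,
      residue_mul_right _ hp.ne_zero hb, star_mul', residue_prime _ hp,
      residue_prime _ (prime_star hp), residuePrime_star hp]

theorem residue_one_left {b : Eis} (hb : b ≠ 0) : residue 1 b = 1 := by
  have h1 := residue_mul_left 1 1 hb
  rw [mul_one] at h1
  have h2 := residue_ne_zero_of_isCoprime hb (isCoprime_one_left (x := b))
  exact mul_left_cancel₀ h2 (by rw [← h1, mul_one])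

theorem residue_pow_left (a : Eis) (n : ℕ) {b : Eis} (hb : b ≠ 0) :
    residue (a ^ n) b = residue a b ^ n := by
  induction n with
  | zero => simp [residue_one_left hb]
  | succ n ih => rw [pow_succ, residue_mul_left _ _ hb, ih, pow_succ]

theorem residue_neg_one {b : Eis} (hb : b ≠ 0) : residue (-1) b = 1 := by
  refine (isCubicValue_residue (-1) hb).eq_one_of_sq_eq_one ?_
  rw [← residue_pow_left _ _ hb, neg_one_sq, residue_one_left hb]

theorem residue_neg_left (a : Eis) {b : Eis} (hb : b ≠ 0) : residue (-a) b = residue a b := by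
  rw [neg_eq_neg_one_mul, residue_mul_left _ _ hb, residue_neg_one hb, one_mul]

theorem residue_neg_right (a b : Eis) : residue a (-b) = residue a b :=
  residue_associated a (Associated.neg_left (Associated.refl b))

end Eis

section GaussSum

variable {F K : Type*} [Field F] [Fintype F] [Field K]

theorem gaussSum_pow_char_pow (χ : MulChar F K) (ψ : AddChar F K) (q n : ℕ) [Fact q.Prime]
    [CharP K q] : gaussSum χ ψ ^ q ^ n = gaussSum (χ ^ q ^ n) (ψ ^ q ^ n) := by
  induction n with
  | zero => simp
  | succ n ih => rw [pow_succ, pow_mul, ih, gaussSum_frob, ← pow_mul, ← pow_mul]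

omit [Fintype F] in
theorem mulChar_neg_one_of_pow_three {χ : MulChar F K} (hχ : χ ^ 3 = 1) : χ (-1) = 1 := by
  have h3 : χ (-1) ^ 3 = 1 := by
    rw [← MulChar.pow_apply' χ (by norm_num), hχ, MulChar.one_apply (isUnit_one.neg)]
  have h2 : χ (-1) ^ 2 = 1 := by rw [← map_pow, neg_one_sq, map_one]
  linear_combination h3 - χ (-1) * h2

/-- The evaluation of the cube of the Gauss sum of a cubic character in characteristic `q`. -/
theorem card_mul_jacobiSum_pow {χ : MulChar F K} (h1 : χ ≠ 1) (h3 : χ ^ 3 = 1)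
    {ψ : AddChar F K} (hψ : ψ.IsPrimitive) (q n : ℕ) [Fact q.Prime] [CharP K q]
    (hcard : (Fintype.card F : K) ≠ 0) (hq : (q : F) ≠ 0) (hn : q ^ n % 3 = 1) :
    ((Fintype.card F : K) * jacobiSum χ χ) ^ ((q ^ n - 1) / 3) * χ ((q ^ n : ℕ) : F) = 1 := by
  have ho : orderOf χ = 3 := orderOf_eq_prime h3 h1
  have hg := gaussSum_pow_eq_prod_jacobiSum (χ := χ) (ψ := ψ) (by omega) hψ
  rw [ho] at hg
  have hI : Finset.Ico 1 (3 - 1) = {1} := rfl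
  rw [hI, Finset.prod_singleton, pow_one, mulChar_neg_one_of_pow_three h3, one_mul] at hg
  have h0 := gaussSum_ne_zero_of_nontrivial hcard h1 hψ
  have hu : ((q ^ n : ℕ) : F) ≠ 0 := by
    rw [Nat.cast_pow]; exact pow_ne_zero _ hq
  have hf := gaussSum_pow_char_pow χ ψ q n
  have hχ : χ ^ q ^ n = χ := by
    conv_lhs => rw [← Nat.div_add_mod (q ^ n) 3, pow_add, pow_mul, h3, one_pow, one_mul, hn,
      pow_one]
  have hψ' : ψ ^ q ^ n = AddChar.mulShift ψ ((q ^ n : ℕ) : F) := AddChar.pow_mulShift ψ _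
  have hs := gaussSum_mulShift χ ψ (Units.mk0 _ hu)
  rw [hχ, hψ'] at hf
  rw [Units.val_mk0, ← hf] at hs
  rw [← hg, ← pow_mul]
  have he : 3 * ((q ^ n - 1) / 3) + 1 = q ^ n := by omega
  apply mul_right_cancel₀ h0
  rw [one_mul, mul_right_comm, ← pow_succ, he, mul_comm]
  exact hs

theorem sum_pow_mul_one_sub_pow (m : ℕ) (h : 2 * m < Fintype.card F - 1) :
    ∑ x : F, x ^ m * (1 - x) ^ m = 0 := by
  have e : ∀ x : F, x ^ m * (1 - x) ^ m =
      ∑ i ∈ Finset.range (m + 1), ((-1) ^ i * (m.choose i : F)) * x ^ (m + i) := by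
    intro x
    rw [sub_eq_neg_add, add_pow, Finset.mul_sum]
    refine Finset.sum_congr rfl fun i _ => ?_
    rw [neg_pow, one_pow, pow_add]
    ring
  simp_rw [e]
  rw [Finset.sum_comm]
  refine Finset.sum_eq_zero fun i hi => ?_
  rw [← Finset.mul_sum, FiniteField.sum_pow_lt_card_sub_one, mul_zero]
  have := Finset.mem_range.1 hi
  omega

end GaussSum

namespace Eis

section CubicChar

variable {F : Type*} [Field F] {p : Eis} {red : Eis →+* F}

/-- The cubic residue character as a multiplicative character of the residue field. -/
theorem exists_cubicChar (hp : Prime p) (h3 : ¬ p ∣ 3) (hs : Function.Surjective red)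
    (hk : ∀ a, red a = 0 ↔ p ∣ a) :
    ∃ χ : MulChar F Eis, ∀ a, χ (red a) = residuePrime a p := by
  have hc : ∀ a b, red a = red b → residuePrime a p = residuePrime b p := fun a b h =>
    residuePrime_congr hp ((hk _).1 (by rw [map_sub, h, sub_self]))
  have hg : ∀ x, red (Function.surjInv hs x) = x := Function.surjInv_eq hs
  refine ⟨{ toFun := fun x => residuePrime (Function.surjInv hs x) p
            map_one' := ?_
            map_mul' := fun x y => ?_
            map_nonunit' := fun x hx => ?_ }, fun a => ?_⟩
  · rw [hc _ 1 (by rw [hg, map_one]), ← residue_prime _ hp, residue_one_left hp.ne_zero]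
  · rw [← residuePrime_mul hp]
    exact hc _ _ (by rw [hg, map_mul, hg, hg])
  · rw [residuePrime_eq_zero_iff]
    refine ⟨h3, (hk _).1 ?_⟩
    rw [hg]
    by_contra h
    exact hx (isUnit_iff_ne_zero.2 h)
  · exact hc _ _ (hg _)

variable {χ : MulChar F Eis}

theorem isCubicValue_cubicChar (hs : Function.Surjective red)
    (hχ : ∀ a, χ (red a) = residuePrime a p) (x : F) : IsCubicValue (χ x) := by
  obtain ⟨a, rfl⟩ := hs x
  rw [hχ]
  exact isCubicValue_residuePrime a p

theorem cubicChar_pow_three (hs : Function.Surjective red)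
    (hχ : ∀ a, χ (red a) = residuePrime a p) : χ ^ 3 = 1 := by
  refine MulChar.ext fun x => ?_
  rw [MulChar.pow_apply_coe, MulChar.one_apply_coe]
  exact (isCubicValue_cubicChar hs hχ _).pow_three (x.isUnit.map χ).ne_zero

variable [Fintype F]

theorem red_cubicChar (hp : Prime p) (h3 : ¬ p ∣ 3) (hs : Function.Surjective red)
    (hk : ∀ a, red a = 0 ↔ p ∣ a) (hcard : Fintype.card F = p.norm.toNat)
    (hχ : ∀ a, χ (red a) = residuePrime a p) (x : F) :
    red (χ x) = x ^ ((Fintype.card F - 1) / 3) := by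
  obtain ⟨a, rfl⟩ := hs x
  rw [hχ, hcard, ← map_pow, eq_comm, ← sub_eq_zero, ← map_sub, hk]
  exact dvd_pow_sub_residuePrime hp h3 a

omit [Field F] in
theorem three_dvd_card_sub_one (hp : Prime p) (h3 : ¬ p ∣ 3)
    (hcard : Fintype.card F = p.norm.toNat) : 3 ∣ Fintype.card F - 1 := by
  rw [hcard]
  exact three_dvd_toNat_norm_sub_one (fun h => h3 ((dvd_three_iff_lam_dvd hp).2 h))

theorem cubicChar_ne_one (hp : Prime p) (h3 : ¬ p ∣ 3) (hs : Function.Surjective red)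
    (hk : ∀ a, red a = 0 ↔ p ∣ a) (hcard : Fintype.card F = p.norm.toNat)
    (hχ : ∀ a, χ (red a) = residuePrime a p) : χ ≠ 1 := by
  rintro rfl
  have h : ∀ x : Fˣ, x ^ ((Fintype.card F - 1) / 3) = 1 := by
    intro x
    have := red_cubicChar hp h3 hs hk hcard hχ x
    rw [MulChar.one_apply_coe, map_one] at this
    ext
    simpa using this.symm
  have h1 := Nat.le_of_dvd (by rw [hcard]; exact pow_card_sub_one_pos hp h3)
    ((FiniteField.forall_pow_eq_one_iff F _).1 h)
  have h2 := Fintype.one_lt_card (α := F)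
  omega

theorem dvd_jacobiSum_cubicChar (hp : Prime p) (h3 : ¬ p ∣ 3) (hs : Function.Surjective red)
    (hk : ∀ a, red a = 0 ↔ p ∣ a) (hcard : Fintype.card F = p.norm.toNat)
    (hχ : ∀ a, χ (red a) = residuePrime a p) : p ∣ jacobiSum χ χ := by
  rw [← hk, jacobiSum, map_sum]
  simp_rw [map_mul, red_cubicChar hp h3 hs hk hcard hχ]
  apply sum_pow_mul_one_sub_pow
  have := Fintype.one_lt_card (α := F)
  omega

theorem jacobiSum_cubicChar_mul_star (hp : Prime p) (h3 : ¬ p ∣ 3) (hs : Function.Surjective red)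
    (hk : ∀ a, red a = 0 ↔ p ∣ a) (hcard : Fintype.card F = p.norm.toNat)
    (hχ : ∀ a, χ (red a) = residuePrime a p) :
    jacobiSum χ χ * star (jacobiSum χ χ) = p.norm := by
  have hst : χ.ringHomComp (starRingEnd Eis) = χ⁻¹ := by
    rw [eq_inv_iff_mul_eq_one]
    refine MulChar.ext fun x => ?_
    rw [MulChar.mul_apply, MulChar.ringHomComp_apply, MulChar.one_apply_coe, starRingEnd_apply]
    have h0 := (x.isUnit.map χ).ne_zero
    rw [mul_comm]
    exact ((isCubicValue_cubicChar hs hχ _).mul (isCubicValue_cubicChar hs hχ _).star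
      ).eq_one_of_star_eq
      (mul_ne_zero h0 (by simpa using h0)) (by rw [star_mul', star_star, mul_comm])
  have h1 := cubicChar_ne_one hp h3 hs hk hcard hχ
  have h2 : χ * χ ≠ 1 := by
    intro h
    apply h1
    rw [← cubicChar_pow_three hs hχ, pow_succ, pow_two, h, one_mul]
  have hinj : Function.Injective (algebraMap Eis (FractionRing Eis)) :=
    IsFractionRing.injective Eis (FractionRing Eis)
  have hchar : ringChar (FractionRing Eis) ≠ ringChar F := by
    rw [ringChar.eq_zero]
    exact (CharP.ringChar_ne_zero_of_finite F).symm
  have key := jacobiSum_mul_jacobiSum_inv hchar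
    ((MulChar.ringHomComp_ne_one_iff hinj).mpr h1) ((MulChar.ringHomComp_ne_one_iff hinj).mpr h1)
    (by rw [← MulChar.ringHomComp_mul]; exact (MulChar.ringHomComp_ne_one_iff hinj).mpr h2)
  rw [MulChar.ringHomComp_inv, ← hst, jacobiSum_ringHomComp, jacobiSum_ringHomComp,
    jacobiSum_ringHomComp, ← map_mul, starRingEnd_apply] at key
  apply hinj
  rw [key, hcard]
  have hz : ((p.norm.toNat : ℤ) : FractionRing Eis) = (p.norm : FractionRing Eis) := by
    rw [Int.toNat_of_nonneg (norm_nonneg p)]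
  rw [map_intCast, ← hz, Int.cast_natCast]

theorem isPrimitiveRoot_zeta3 : IsPrimitiveRoot zeta3 3 := by
  rw [IsPrimitiveRoot.iff_orderOf]
  refine orderOf_eq_prime zeta3_cube ?_
  intro h
  have := congrArg QuadraticAlgebra.im h
  simp [zeta3] at this

theorem three_dvd_jacobiSum_cubicChar_add_one (hp : Prime p) (h3 : ¬ p ∣ 3)
    (hs : Function.Surjective red) (hcard : Fintype.card F = p.norm.toNat)
    (hχ : ∀ a, χ (red a) = residuePrime a p) : 3 ∣ jacobiSum χ χ + 1 := by
  have h := cubicChar_pow_three hs hχ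
  obtain ⟨z, -, hz⟩ := exists_jacobiSum_eq_neg_one_add (by norm_num) h h
    (three_dvd_card_sub_one hp h3 hcard) isPrimitiveRoot_zeta3
  exact ⟨-(z * zeta3), by rw [hz]; linear_combination z * zeta3_sq⟩

/-- The prime factorization of the cube of a cubic Gauss sum, reduced modulo another prime. -/
theorem residuePrime_card_mul_jacobiSum (hp : Prime p) (h3 : ¬ p ∣ 3)
    (hs : Function.Surjective red)
    (hk : ∀ a, red a = 0 ↔ p ∣ a) (hcard : Fintype.card F = p.norm.toNat)
    (hχ : ∀ a, χ (red a) = residuePrime a p) {r : Eis} (hr : Prime r) (hr3 : ¬ r ∣ 3)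
    (hrp : ¬ r ∣ (p.norm : Eis)) :
    residuePrime (p.norm * jacobiSum χ χ) r * residuePrime r.norm p = 1 := by
  have := isMaximal_span hr
  let k := Eis ⧸ Ideal.span {r}
  let := Ideal.Quotient.field (Ideal.span {r})
  have := finite_quotient hr.ne_zero
  let := Fintype.ofFinite k
  have hkcard : Fintype.card k = r.norm.toNat := by
    rw [← natCard_quotient, Nat.card_eq_fintype_card]
  have hcast : ∀ (R : Type) [CommRing R] (z : Eis), ((z.norm.toNat : ℕ) : R) = ((z.norm : ℤ) : R) := by
    intro R _ z
    conv_rhs => rw [← Int.toNat_of_nonneg (norm_nonneg z), Int.cast_natCast]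
  have hk0 : ((Fintype.card F : ℕ) : k) ≠ 0 := by
    rw [hcard, hcast]
    intro h
    apply hrp
    rw [← mk_eq_zero_iff, map_intCast]
    exact h
  obtain ⟨m, hqF, hcF⟩ := FiniteField.card F (ringChar F)
  obtain ⟨n, hq, hcn⟩ := FiniteField.card k (ringChar k)
  have hchar : ringChar k ≠ ringChar F := by
    intro h
    apply hk0
    rw [hcF, ← h, Nat.cast_pow, ringChar.Nat.cast_ringChar, zero_pow m.ne_zero]
  let ψ := AddChar.FiniteField.primitiveChar F k hchar
  let K := CyclotomicField ψ.n k
  let f : Eis →+* K := (algebraMap k K).comp (Ideal.Quotient.mk (Ideal.span {r}))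
  have hf : ∀ a, f a = 0 ↔ r ∣ a := by
    intro a
    rw [← mk_eq_zero_iff]
    exact map_eq_zero_iff _ (algebraMap k K).injective
  have hfv : ∀ {x y : Eis}, IsCubicValue x → IsCubicValue y → f x = f y → x = y := by
    intro x y hx hy h
    exact hx.eq_of_dvd_sub hy hr3 ((hf _).1 (by rw [map_sub, h, sub_self]))
  have hcK : CharP K (ringChar k) := charP_of_injective_algebraMap (algebraMap k K).injective _
  have := Fact.mk hq
  have h1 : χ.ringHomComp f ≠ 1 := by
    intro h
    apply cubicChar_ne_one hp h3 hs hk hcard hχ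
    refine MulChar.ext fun x => ?_
    apply hfv (isCubicValue_cubicChar hs hχ _)
    · rw [MulChar.one_apply_coe]; exact isCubicValue_one
    · rw [← MulChar.ringHomComp_apply, h, MulChar.one_apply_coe, MulChar.one_apply_coe, map_one]
  have h3' : (χ.ringHomComp f) ^ 3 = 1 := by
    rw [MulChar.ringHomComp_pow, cubicChar_pow_three hs hχ, MulChar.ringHomComp_one]
  have key := card_mul_jacobiSum_pow h1 h3' ψ.prim (ringChar k) n (K := K) ?_ ?_ ?_
  · rw [← hcn, hkcard, jacobiSum_ringHomComp, MulChar.ringHomComp_apply] at key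
    refine ((isCubicValue_residuePrime _ _).mul (isCubicValue_residuePrime _ _)).eq_of_dvd_sub
      isCubicValue_one hr3 ?_
    rw [← hf, map_sub, map_one, sub_eq_zero, ← key, map_mul]
    congr 1
    · have := (hf _).2 (dvd_pow_sub_residuePrime hr hr3 (p.norm * jacobiSum χ χ))
      rw [map_sub, sub_eq_zero, map_pow, map_mul] at this
      rw [← this, map_intCast, hcard]
      congr 2
      rw [← Int.cast_natCast, Int.toNat_of_nonneg (norm_nonneg p)]
    · rw [← hχ, map_intCast, ← Int.cast_natCast, Int.toNat_of_nonneg (norm_nonneg r)]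
  · intro h
    apply hk0
    apply (algebraMap k K).injective
    rw [map_natCast, h, map_zero]
  · intro h
    rw [ringChar.spec] at h
    exact hchar ((Nat.prime_dvd_prime_iff_eq hqF hq).1 h).symm
  · rw [← hcn, hkcard]
    have := norm_emod_three (fun h => hr3 ((dvd_three_iff_lam_dvd hr).2 h))
    have := norm_nonneg r
    omega

end CubicChar

/-- `z` is primary in `ℤ[ζ₃]` if `z ≡ ± 1 (mod 3)`. -/
def IsPrimary (z : Eis) : Prop := 3 ∣ z - 1 ∨ 3 ∣ z + 1

theorem isPrimary_iff (z : Eis) : IsPrimary z ↔ ¬ (3 : ℤ) ∣ z.re ∧ (3 : ℤ) ∣ z.im := by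
  unfold IsPrimary
  rw [ofNat_dvd_iff, ofNat_dvd_iff]
  simp
  omega

theorem IsPrimary.not_lam_dvd {z : Eis} (h : IsPrimary z) : ¬ lam ∣ z := by
  rw [isPrimary_iff] at h
  rw [lam_dvd_iff]
  omega

theorem IsPrimary.ne_zero {z : Eis} (h : IsPrimary z) : z ≠ 0 := by
  rintro rfl
  exact h.not_lam_dvd (dvd_zero _)

theorem IsPrimary.not_dvd_three {z : Eis} (h : IsPrimary z) (hp : Prime z) : ¬ z ∣ 3 := fun h' =>
  h.not_lam_dvd ((dvd_three_iff_lam_dvd hp).1 h')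

theorem IsPrimary.neg {z : Eis} (h : IsPrimary z) : IsPrimary (-z) := by
  rw [isPrimary_iff] at *
  simpa using h

theorem IsPrimary.mul {z w : Eis} (hz : IsPrimary z) (hw : IsPrimary w) : IsPrimary (z * w) := by
  rcases hz with ⟨c, hc⟩ | ⟨c, hc⟩ <;> rcases hw with ⟨d, hd⟩ | ⟨d, hd⟩
  · exact Or.inl ⟨c * w + d, by linear_combination w * hc + hd⟩
  · exact Or.inr ⟨c * w + d, by linear_combination w * hc + hd⟩
  · exact Or.inr ⟨c * w - d, by linear_combination w * hc - hd⟩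
  · exact Or.inl ⟨c * w - d, by linear_combination w * hc - hd⟩

theorem IsPrimary.of_mul_left {z w : Eis} (hz : IsPrimary z) (h : IsPrimary (z * w)) :
    IsPrimary w := by
  rcases hz with ⟨c, hc⟩ | ⟨c, hc⟩ <;> rcases h with ⟨d, hd⟩ | ⟨d, hd⟩
  · exact Or.inl ⟨d - c * w, by linear_combination hd - w * hc⟩
  · exact Or.inr ⟨d - c * w, by linear_combination hd - w * hc⟩
  · exact Or.inr ⟨c * w - d, by linear_combination w * hc - hd⟩
  · exact Or.inl ⟨c * w - d, by linear_combination w * hc - hd⟩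

theorem IsPrimary.star {z : Eis} (h : IsPrimary z) : IsPrimary (star z) := by
  rw [isPrimary_iff] at *
  simp
  omega

theorem eq_one_or_neg_one_of_isPrimary {u : Eis} (hu : IsUnit u) (h : IsPrimary u) :
    u = 1 ∨ u = -1 := by
  rw [isPrimary_iff] at h
  rw [isUnit_iff_norm, norm_eq] at hu
  obtain ⟨h1, k, hk⟩ := h
  have h2 : (2 * u.re - u.im) ^ 2 + 3 * u.im ^ 2 = 4 := by linear_combination 4 * hu
  have h4 : k = 0 := by
    rw [hk] at h2
    have h5 : k ^ 2 < 1 := by nlinarith [sq_nonneg (2 * u.re - 3 * k)]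
    nlinarith [sq_nonneg k, (sq_eq_zero_iff (a := k)).1 (by nlinarith [sq_nonneg k])]
  rw [h4, mul_zero] at hk
  rw [hk] at hu
  have h6 : u.re = 1 ∨ u.re = -1 := by
    rw [← sq_eq_one_iff]
    linear_combination hu
  rcases h6 with h6 | h6
  · left; ext <;> simp [h6, hk]
  · right; ext <;> simp [h6, hk]

theorem exists_residuePrime_relation {p : Eis} (hp : Prime p) (h : IsPrimary p) {r : Eis}
    (hr : Prime r) (hr3 : ¬ r ∣ 3) (hrp : ¬ r ∣ (p.norm : Eis)) :
    residuePrime (p ^ 2 * star p) r * residuePrime (r * star r) p = 1 := by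
  have h3 := h.not_dvd_three hp
  have := isMaximal_span hp
  let := Ideal.Quotient.field (Ideal.span {p})
  have := finite_quotient hp.ne_zero
  let := Fintype.ofFinite (Eis ⧸ Ideal.span {p})
  have hcard : Fintype.card (Eis ⧸ Ideal.span {p}) = p.norm.toNat := by
    rw [← natCard_quotient, Nat.card_eq_fintype_card]
  have hs := Ideal.Quotient.mk_surjective (I := Ideal.span {p})
  have hk := mk_eq_zero_iff p
  obtain ⟨χ, hχ⟩ := exists_cubicChar hp h3 hs hk
  obtain ⟨c, hc⟩ := dvd_jacobiSum_cubicChar hp h3 hs hk hcard hχ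
  have hn := jacobiSum_cubicChar_mul_star hp h3 hs hk hcard hχ
  have hu : c * star c = 1 := by
    have hN : (p.norm : Eis) ≠ 0 := by exact_mod_cast (norm_pos hp.ne_zero).ne'
    rw [hc, star_mul'] at hn
    apply mul_left_cancel₀ hN
    rw [← mul_star_self] at hn ⊢
    linear_combination hn
  have hcp : IsPrimary c := h.of_mul_left (hc ▸
    Or.inr (three_dvd_jacobiSum_cubicChar_add_one hp h3 hs hcard hχ))
  have key := residuePrime_card_mul_jacobiSum hp h3 hs hk hcard hχ hr hr3 hrp
  rw [hc, ← mul_star_self, ← mul_star_self] at key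
  rcases eq_one_or_neg_one_of_isPrimary (IsUnit.of_mul_eq_one _ hu) hcp with rfl | rfl
  · rw [← key]; congr 2; ring
  · rw [← key, ← residue_prime _ hr, ← residue_prime _ hr, ← residue_neg_left _ hr.ne_zero]
    congr 2; ring

end Eis

namespace Eis

theorem isUnit_zeta3 : IsUnit zeta3 := IsUnit.of_pow_eq_one zeta3_cube (by norm_num)

theorem exists_pow_mul_isPrimary {z : Eis} (h : ¬ lam ∣ z) : ∃ k : ℕ, IsPrimary (zeta3 ^ k * z) := by
  rw [lam_dvd_iff] at h
  have h1 : (3 : ℤ) ∣ z.im ∨ (3 : ℤ) ∣ z.re - z.im ∨ (3 : ℤ) ∣ z.re := by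
    have h2 : z.re % 3 = 0 ∨ z.re % 3 = 1 ∨ z.re % 3 = 2 := by omega
    rcases h2 with h2 | h2 | h2 <;> omega
  rcases h1 with h1 | h1 | h1
  · refine ⟨0, ?_⟩
    rw [isPrimary_iff, pow_zero, one_mul]
    omega
  · refine ⟨1, ?_⟩
    rw [isPrimary_iff, pow_one]
    simp [zeta3]
    omega
  · refine ⟨2, ?_⟩
    rw [isPrimary_iff, zeta3_sq_eq]
    simp
    omega

theorem eq_zeta3_pow_mul (k : ℕ) (z : Eis) : z = zeta3 ^ (2 * k) * (zeta3 ^ k * z) := by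
  rw [← mul_assoc, ← pow_add, show 2 * k + k = 3 * k by ring, pow_mul, zeta3_cube, one_pow, one_mul]

theorem isPrimary_one : IsPrimary 1 := Or.inl (by simp)

/-- Induction on a factorization into primary primes. -/
theorem induction_primary {P : ∀ b, IsPrimary b → Prop} (h1 : P 1 isPrimary_one)
    (h1' : P (-1) isPrimary_one.neg)
    (h2 : ∀ p b (_ : Prime p) (hp : IsPrimary p) (hb : IsPrimary b), P b hb → P (p * b) (hp.mul hb))
    (b : Eis) (hb : IsPrimary b) : P b hb := by
  have key : ∀ c : Eis, c ≠ 0 → ∀ u : Eisˣ, ∀ h : IsPrimary (u * c), P (u * c) h := by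
    intro c hc
    induction c, hc using induction_prime with
    | h1 v hv =>
      intro u hu
      obtain h | h := eq_one_or_neg_one_of_isPrimary (u.isUnit.mul hv) hu
      · simpa only [h] using h1
      · simpa only [h] using h1'
    | h2 p c hp hc ih =>
      intro u hu
      have hlam : ¬ lam ∣ p := fun h => hu.not_lam_dvd ((h.mul_right c).mul_left _)
      obtain ⟨k, hk⟩ := exists_pow_mul_isPrimary hlam
      have e : (u : Eis) * (p * c) =
          (zeta3 ^ k * p) * (((u * isUnit_zeta3.unit ^ (2 * k) : Eisˣ) : Eis) * c) := by
        conv_lhs => rw [eq_zeta3_pow_mul k p]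
        push_cast
        rw [IsUnit.unit_spec]
        ring
      revert hu
      rw [e]
      intro hu
      have hc' := hk.of_mul_left hu
      refine h2 _ _ ?_ hk hc' (ih _ hc')
      exact (associated_unit_mul_left p _ (isUnit_zeta3.pow k)).symm.prime hp
  have := key b hb.ne_zero 1
  rw [Units.val_one, one_mul] at this
  exact this hb

theorem residue_neg_one_right (a : Eis) : residue a (-1) = 1 := residue_unit a isUnit_one.neg

/-! ### Cubic reciprocity -/

theorem dvd_of_prime_dvd {p q : Eis} (hp : Prime p) (hq : Prime q) (h : p ∣ q) : q ∣ p :=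
  (hp.associated_of_dvd hq h).symm.dvd

theorem residue_comm_of_not_dvd_norm {p r : Eis} (hp : Prime p) (hpp : IsPrimary p) (hr : Prime r)
    (hrp : IsPrimary r) (h : ¬ r ∣ (p.norm : Eis)) : residue p r = residue r p := by
  have h' : ¬ p ∣ (r.norm : Eis) := by
    rw [← mul_star_self] at *
    intro h1
    rcases hp.dvd_or_dvd h1 with h1 | h1
    · exact h ((dvd_of_prime_dvd hp hr h1).mul_right _)
    · have h2 := dvd_of_prime_dvd hp (prime_star hr) h1
      rw [← star_dvd_star, star_star] at h2
      exact h (h2.mul_left _)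
  have e1 := exists_residuePrime_relation hp hpp hr (hrp.not_dvd_three hr) h
  have e2 := exists_residuePrime_relation hr hrp hp (hpp.not_dvd_three hp) h'
  rw [pow_two] at e1 e2
  simp only [residuePrime_mul hr, residuePrime_mul hp] at e1 e2
  rw [residue_prime _ hr, residue_prime _ hp]
  generalize residuePrime p r = a at *
  generalize residuePrime (star p) r = a' at *
  generalize residuePrime r p = b at *
  generalize residuePrime (star r) p = b' at *
  linear_combination b * e1 - a * e2

theorem residue_comm_prime_of_not_dvd_norm {p a : Eis} (hp : Prime p) (hpp : IsPrimary p)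
    (ha : IsPrimary a) (h : ¬ p ∣ (a.norm : Eis)) : residue a p = residue p a := by
  revert h
  induction a, ha using induction_primary with
  | h1 => intro _; rw [residue_one_left hp.ne_zero, residue_unit _ isUnit_one]
  | h1' => intro _; rw [residue_neg_one hp.ne_zero, residue_neg_one_right]
  | h2 q b hq hqp hb ih =>
    intro h
    rw [map_mul, Int.cast_mul] at h
    rw [residue_mul_left _ _ hp.ne_zero, residue_mul_right _ hq.ne_zero hb.ne_zero,
      ih fun h' => h (h'.mul_left _),
      residue_comm_of_not_dvd_norm hq hqp hp hpp fun h' => h (h'.mul_right _)]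

theorem residue_star_self {p : Eis} (hp : Prime p) (hpp : IsPrimary p) (h : ¬ p ∣ star p) :
    residue (star p) p = 1 := by
  set t := p + star p with ht
  have hts : star t = t := by rw [ht, star_add, star_star, add_comm]
  have htp : IsPrimary t := by
    rw [isPrimary_iff] at hpp ⊢
    simp [ht]
    omega
  have hpt : ¬ p ∣ t := fun h' => h ((dvd_add_right dvd_rfl).1 h')
  have hn : ¬ p ∣ (t.norm : Eis) := by
    rw [← mul_star_self, hts]
    exact fun h' => (hp.dvd_or_dvd h').elim hpt hpt
  have e1 : residue (star p) p = residue t p :=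
    residue_congr hp.ne_zero ⟨-1, by rw [ht]; ring⟩
  have e2 := residue_comm_prime_of_not_dvd_norm hp hpp htp hn
  rw [e1]
  refine (isCubicValue_residue t hp.ne_zero).eq_one_of_star_eq ?_ ?_
  · rw [residue_prime _ hp, Ne, residuePrime_eq_zero_iff]
    exact fun h' => hpt h'.2
  · rw [e2, ← residue_star _ htp.ne_zero, hts, ← residue_neg_left _ htp.ne_zero]
    exact residue_congr htp.ne_zero ⟨-1, by rw [ht]; ring⟩

theorem residue_comm_prime {p r : Eis} (hp : Prime p) (hpp : IsPrimary p) (hr : Prime r)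
    (hrp : IsPrimary r) : residue p r = residue r p := by
  have hz : r ∣ p → residue p r = residue r p := by
    intro h
    rw [residue_prime _ hr, residue_prime _ hp, (residuePrime_eq_zero_iff _ _).2
      ⟨hrp.not_dvd_three hr, h⟩, (residuePrime_eq_zero_iff _ _).2
      ⟨hpp.not_dvd_three hp, dvd_of_prime_dvd hr hp h⟩]
  by_cases h : r ∣ (p.norm : Eis)
  · rw [← mul_star_self] at h
    rcases hr.dvd_or_dvd h with h | h
    · exact hz h
    · by_cases h' : p ∣ star p
      · exact hz (h.trans (dvd_of_prime_dvd hp (prime_star hp) h'))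
      · have e := residue_star_self hp hpp h'
        obtain ⟨u, hu⟩ := hr.associated_of_dvd (prime_star hp) h
        have hup : IsPrimary (u : Eis) := hrp.of_mul_left (hu ▸ hpp.star)
        have e1 : residue r p = residue (star p) p := by
          rcases eq_one_or_neg_one_of_isPrimary u.isUnit hup with h1 | h1
          · rw [← hu, h1, mul_one]
          · rw [← hu, h1, mul_neg_one, residue_neg_left _ hp.ne_zero]
        have e2 : residue p r = star (residue (star p) p) := by
          rw [← residue_star _ hp.ne_zero, star_star]
          exact residue_associated _ ⟨u, hu⟩
        rw [e1, e2, e, star_one]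
  · exact residue_comm_of_not_dvd_norm hp hpp hr hrp h

/-- Cubic reciprocity for primary elements of `ℤ[ζ₃]`. -/
theorem residue_comm {a b : Eis} (ha : IsPrimary a) (hb : IsPrimary b) :
    residue a b = residue b a := by
  induction a, ha using induction_primary with
  | h1 => rw [residue_one_left hb.ne_zero, residue_unit _ isUnit_one]
  | h1' => rw [residue_neg_one hb.ne_zero, residue_neg_one_right]
  | h2 p a hp hpp ha ih =>
    rw [residue_mul_left _ _ hb.ne_zero, residue_mul_right _ hp.ne_zero ha.ne_zero, ih]
    congr 1
    clear ih
    induction b, hb using induction_primary with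
    | h1 => rw [residue_one_left hp.ne_zero, residue_unit _ isUnit_one]
    | h1' => rw [residue_neg_one hp.ne_zero, residue_neg_one_right]
    | h2 q b hq hqp hb ih =>
      rw [residue_mul_left _ _ hp.ne_zero, residue_mul_right _ hq.ne_zero hb.ne_zero, ih,
        residue_comm_prime hp hpp hq hqp]

/-! ### The supplementary laws -/

theorem residue_zeta3 {b : Eis} (hb : ¬ lam ∣ b) :
    residue zeta3 b = zeta3 ^ ((b.norm.toNat - 1) / 3) := by
  have hb0 : b ≠ 0 := by rintro rfl; exact hb (dvd_zero _)
  induction b, hb0 using induction_prime with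
  | h1 u hu => rw [residue_unit _ hu, (isUnit_iff_norm u).1 hu]; simp
  | h2 p b hp hb0 ih =>
    have hb' : ¬ lam ∣ b := fun h => hb (h.mul_left p)
    have hp' : ¬ lam ∣ p := fun h => hb (h.mul_right b)
    have h3 : ¬ p ∣ 3 := fun h => hp' ((dvd_three_iff_lam_dvd hp).1 h)
    have e : residuePrime zeta3 p = zeta3 ^ ((p.norm.toNat - 1) / 3) := by
      refine residuePrime_eq_of_dvd hp h3 ?_ (by simp)
      rw [isCubicValue_iff, pow_succ, pow_right_comm, zeta3_cube, one_pow, one_mul]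
    rw [residue_mul_right _ hp.ne_zero hb0, residue_prime _ hp, e, ih hb', ← pow_add,
      zeta3_pow_mod, zeta3_pow_mod (((p * b).norm.toNat - 1) / 3), map_mul]
    have h1 := norm_emod_three hb'
    have h2 := norm_emod_three hp'
    have h1' := norm_nonneg b
    have h2' := norm_nonneg p
    obtain ⟨m, hm⟩ : ∃ m : ℕ, b.norm = 3 * m + 1 := ⟨(b.norm / 3).toNat, by omega⟩
    obtain ⟨n, hn⟩ : ∃ n : ℕ, p.norm = 3 * n + 1 := ⟨(p.norm / 3).toNat, by omega⟩
    have e1 : (p.norm * b.norm).toNat = 3 * (3 * (n * m) + n + m) + 1 := by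
      rw [hm, hn]
      zify
      rw [Int.toNat_of_nonneg (by positivity)]
      ring
    rw [e1]
    congr 1
    omega

theorem residue_zeta3_congr {a b : Eis} (ha : IsPrimary a) (hb : IsPrimary b) (h : 9 ∣ a - b) :
    residue zeta3 a = residue zeta3 b := by
  rw [residue_zeta3 ha.not_lam_dvd, residue_zeta3 hb.not_lam_dvd, zeta3_pow_mod,
    zeta3_pow_mod ((b.norm.toNat - 1) / 3)]
  congr 1
  have h1 := norm_emod_three ha.not_lam_dvd
  have h2 := norm_emod_three hb.not_lam_dvd
  have h1' := norm_nonneg a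
  have h2' := norm_nonneg b
  have h9 : (9 : ℤ) ∣ a.norm - b.norm := by
    obtain ⟨c, hc⟩ := h
    have hc' : a = b + 9 * c := by linear_combination hc
    rw [hc', norm_eq, norm_eq]
    simp [QuadraticAlgebra.re_ofNat, QuadraticAlgebra.im_ofNat]
    exact ⟨2 * b.re * c.re + 9 * c.re ^ 2 - b.re * c.im - c.re * b.im - 9 * c.re * c.im
      + 2 * b.im * c.im + 9 * c.im ^ 2, by ring⟩
  omega

theorem isPrimary_one_add_three_mul (c : Eis) : IsPrimary (1 + 3 * c) := Or.inl ⟨c, by ring⟩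

theorem residue_lam_sq_mul {c : Eis} {k : ℕ} (hc : IsPrimary (zeta3 ^ k * c)) :
    residue lam (1 + 3 * c) ^ 2 * residue zeta3 (1 + 3 * c) ^ (2 * k + 2) = 1 := by
  have ha := isPrimary_one_add_three_mul c
  set a := 1 + 3 * c with hac
  have h0 := ha.ne_zero
  have e1 : residue (zeta3 ^ k * c) a = 1 := by
    rw [residue_comm hc ha, residue_congr (a' := 1) hc.ne_zero, residue_one_left hc.ne_zero]
    refine ⟨3 * zeta3 ^ (2 * k), ?_⟩
    rw [hac]
    linear_combination 3 * eq_zeta3_pow_mul k c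
  have e2 : residue (lam ^ 2 * zeta3 ^ (2 * k + 2) * (zeta3 ^ k * c)) a = 1 := by
    rw [residue_congr (a' := 1) h0, residue_one_left h0]
    refine ⟨-1, ?_⟩
    rw [hac, pow_add]
    linear_combination -lam ^ 2 * zeta3 ^ 2 * eq_zeta3_pow_mul k c + c * three_eq
  rw [residue_mul_left _ _ h0, residue_mul_left _ _ h0, e1, mul_one, residue_pow_left _ _ h0,
    residue_pow_left _ _ h0] at e2
  exact e2

theorem residue_lam_congr_of_not_dvd {c d : Eis} (hc : ¬ lam ∣ c) (h : 3 ∣ c - d) :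
    residue lam (1 + 3 * c) = residue lam (1 + 3 * d) := by
  obtain ⟨k, hk⟩ := exists_pow_mul_isPrimary hc
  have hd : IsPrimary (zeta3 ^ k * d) := by
    obtain ⟨e, he⟩ := h
    rcases hk with ⟨f, hf⟩ | ⟨f, hf⟩
    · exact Or.inl ⟨f - zeta3 ^ k * e, by linear_combination hf - zeta3 ^ k * he⟩
    · exact Or.inr ⟨f - zeta3 ^ k * e, by linear_combination hf - zeta3 ^ k * he⟩
  have h1 := residue_lam_sq_mul hk
  have h2 := residue_lam_sq_mul hd
  have ha := isPrimary_one_add_three_mul c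
  have hb := isPrimary_one_add_three_mul d
  have h9 : 9 ∣ (1 + 3 * c) - (1 + 3 * d) := by
    obtain ⟨e, he⟩ := h
    exact ⟨e, by linear_combination 3 * he⟩
  rw [residue_zeta3_congr ha hb h9] at h1
  refine (isCubicValue_residue _ ha.ne_zero).eq_of_sq_eq_sq (isCubicValue_residue _ hb.ne_zero) ?_
  have h3 : residue zeta3 (1 + 3 * d) ^ (2 * k + 2) ≠ 0 := right_ne_zero_of_mul (h2 ▸ one_ne_zero)
  exact mul_right_cancel₀ h3 (h1.trans h2.symm)

theorem residue_lam_congr_aux {c d : Eis} (h : 3 ∣ c - d) :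
    residue lam (1 + 3 * c) = residue lam (1 + 3 * d) := by
  by_cases hc : lam ∣ c
  · have e : ∀ x : Eis, 1 + 3 * (1 + 4 * x) = 4 * (1 + 3 * x) := fun x => by ring
    have h4 : IsPrimary (4 : Eis) := Or.inl ⟨1, by norm_num⟩
    have hl : ¬ lam ∣ 1 + 4 * c := fun h' => prime_lam.not_isUnit
      (isUnit_of_dvd_one ((dvd_add_left (hc.mul_left 4)).1 h'))
    have h1 := residue_lam_congr_of_not_dvd (c := 1 + 4 * c) (d := 1 + 4 * d) hl
      (by obtain ⟨f, hf⟩ := h; exact ⟨4 * f, by linear_combination 4 * hf⟩)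
    rw [e, e, residue_mul_right _ h4.ne_zero (isPrimary_one_add_three_mul c).ne_zero,
      residue_mul_right _ h4.ne_zero (isPrimary_one_add_three_mul d).ne_zero] at h1
    refine mul_left_cancel₀ (residue_ne_zero_of_isCoprime h4.ne_zero ?_) h1
    obtain ⟨f, hf⟩ := lam_dvd_three
    exact ⟨-f, 1, by linear_combination hf⟩
  · exact residue_lam_congr_of_not_dvd hc h

theorem residue_lam_congr {a b : Eis} (ha : IsPrimary a) (h : 9 ∣ a - b) :
    residue lam a = residue lam b := by
  obtain ⟨e, he⟩ := h
  rcases ha with ⟨c, hc⟩ | ⟨c, hc⟩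
  · have h1 := residue_lam_congr_aux (c := c) (d := c - 3 * e) ⟨e, by ring⟩
    rwa [show 1 + 3 * c = a by linear_combination -hc,
      show 1 + 3 * (c - 3 * e) = b by linear_combination -hc + he] at h1
  · have h1 := residue_lam_congr_aux (c := -c) (d := -c + 3 * e) ⟨-e, by ring⟩
    rwa [show 1 + 3 * -c = -a by linear_combination hc,
      show 1 + 3 * (-c + 3 * e) = -b by linear_combination hc - he, residue_neg_right,
      residue_neg_right] at h1

theorem IsPrimary.of_nine_dvd_sub {a b : Eis} (ha : IsPrimary a) (h : 9 ∣ a - b) :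
    IsPrimary b := by
  obtain ⟨e, he⟩ := h
  rcases ha with ⟨c, hc⟩ | ⟨c, hc⟩
  · exact Or.inl ⟨c - 3 * e, by linear_combination hc - he⟩
  · exact Or.inr ⟨c - 3 * e, by linear_combination hc - he⟩

/-- The symbol `[s / b]`, for primary `b`, depends only on `b` modulo `9` and modulo `s`. -/
theorem residue_congr_right {s a b : Eis} (ha : IsPrimary a) (h9 : 9 ∣ a - b) (h : s ∣ a - b) :
    residue s a = residue s b := by
  by_cases hs : s = 0
  · rw [hs, zero_dvd_iff, sub_eq_zero] at h
    rw [h]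
  have hb := ha.of_nine_dvd_sub h9
  obtain ⟨j, c, hc, rfl⟩ := WfDvdMonoid.max_power_factor hs prime_lam.irreducible
  obtain ⟨k, hk⟩ := exists_pow_mul_isPrimary hc
  have e : residue (zeta3 ^ k * c) a = residue (zeta3 ^ k * c) b := by
    rw [residue_comm hk ha, residue_comm hk hb]
    refine residue_congr hk.ne_zero ?_
    rw [(isUnit_zeta3.pow k).mul_left_dvd]
    exact (dvd_mul_left _ _).trans h
  rw [eq_zeta3_pow_mul k c]
  simp only [residue_mul_left _ _ ha.ne_zero, residue_mul_left _ _ hb.ne_zero,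
    residue_pow_left _ _ ha.ne_zero, residue_pow_left _ _ hb.ne_zero] at e ⊢
  rw [e, residue_lam_congr ha h9, residue_zeta3_congr ha hb h9]

end Eis

namespace Eis

theorem exists_isCoprime_add_mul {a b n : Eis} (h : IsCoprime a b) (hn : n ≠ 0) :
    ∃ t, IsCoprime (a + b * t) n := by
  induction n, hn using induction_prime with
  | h1 u hu => obtain ⟨v, hv⟩ := hu.exists_left_inv; exact ⟨0, 0, v, by rw [hv]; ring⟩
  | h2 p m hp hm ih =>
    obtain ⟨t, ht⟩ := ih
    by_cases hpt : p ∣ a + b * t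
    · have hpm : ¬ p ∣ m := fun h' => hp.not_isUnit (ht.isUnit_of_dvd' hpt h')
      have hpb : ¬ p ∣ b := fun h' => hp.not_isUnit
        (h.isUnit_of_dvd' ((dvd_add_left (h'.mul_right t)).1 hpt) h')
      have e : a + b * (t + m) = a + b * t + b * m := by ring
      refine ⟨t + m, IsCoprime.mul_right ?_ ?_⟩
      · rw [isCoprime_comm, hp.irreducible.coprime_iff_not_dvd, e, dvd_add_right hpt]
        exact fun h' => (hp.dvd_or_dvd h').elim hpb hpm
      · rw [e]
        exact ht.add_mul_right_left b
    · exact ⟨t, IsCoprime.mul_right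
        ((hp.irreducible.coprime_iff_not_dvd.2 hpt).symm) ht⟩

/-- The square root `1 + 2 ζ₃` of `-3`. -/
def sqrtNegThree : Eis := ⟨1, 2⟩

theorem sqrtNegThree_sq : sqrtNegThree ^ 2 = -3 := by
  rw [pow_two]
  ext <;> simp [sqrtNegThree, QuadraticAlgebra.re_ofNat, QuadraticAlgebra.im_ofNat]

local notation "θ" => sqrtNegThree

theorem residue_fifteen_mul_sqrtNegThree : residue (15 * θ) 26 = 1 := by
  have h : (26 : Eis) ≠ 0 := by norm_num
  refine (isCubicValue_residue _ h).eq_one_of_sq_eq_one ?_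
  rw [← residue_pow_left _ _ h, residue_congr (a' := 1) h, residue_one_left h]
  exact ⟨-26, by linear_combination 225 * sqrtNegThree_sq⟩

theorem isCoprime_twentysix : IsCoprime (26 : Eis) (45 * θ) :=
  ⟨701, 135 * θ, by linear_combination 6075 * sqrtNegThree_sq⟩

/-- Invariance of `[s / r]` under multiplication of `r + i s` by `26 - 15 i √-3`. -/
theorem residue_unit_mul {r s : Eis} (hr : IsPrimary r) (hs : 3 ∣ s) :
    residue (26 * s - 15 * θ * r) (26 * r + 15 * θ * s) = residue s r := by
  set R := 26 * r + 15 * θ * s with hR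
  set S := 26 * s - 15 * θ * r with hS
  have hRp : IsPrimary R := by
    obtain ⟨e, he⟩ := hs
    rcases hr with ⟨c, hc⟩ | ⟨c, hc⟩
    · exact Or.inr ⟨26 * c + 15 * θ * e + 9, by rw [hR]; linear_combination 26 * hc + 15 * θ * he⟩
    · exact Or.inl ⟨26 * c + 15 * θ * e - 9, by rw [hR]; linear_combination 26 * hc + 15 * θ * he⟩
  obtain ⟨t, ht⟩ := exists_isCoprime_add_mul isCoprime_twentysix hRp.ne_zero
  set d := 26 + 45 * θ * t with hd
  set s' := s - 3 * t * r with hs'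
  have hdp : IsPrimary d := Or.inr ⟨9 + 15 * θ * t, by rw [hd]; ring⟩
  have hR' : R = d * r + 15 * θ * s' := by rw [hR, hd, hs']; ring
  have hd0 := hdp.ne_zero
  have e1 : residue d R * residue S R = residue s' R := by
    rw [← residue_mul_left _ _ hRp.ne_zero]
    refine residue_congr hRp.ne_zero ⟨78 * t - 15 * θ, ?_⟩
    rw [hd, hS, hs', hR]
    linear_combination (225 * s - 675 * t * r) * sqrtNegThree_sq
  have e2 : residue s' R = residue s' d * residue s r := by
    have h9 : 9 ∣ R - d * r := by
      obtain ⟨e, he⟩ := hs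
      exact ⟨5 * θ * (e - t * r), by rw [hR', hs']; linear_combination 15 * θ * he⟩
    rw [residue_congr_right hRp h9 ⟨15 * θ, by rw [hR']; ring⟩,
      residue_mul_right _ hd0 hr.ne_zero]
    congr 1
    exact residue_congr hr.ne_zero ⟨-3 * t, by rw [hs']; ring⟩
  have e3 : residue d R = residue s' d := by
    rw [residue_comm hdp hRp, residue_congr (a' := 15 * θ * s') hd0 ⟨r, by rw [hR']; ring⟩,
      residue_mul_left _ _ hd0, residue_congr_right (b := 26) hdp ⟨5 * θ * t, by rw [hd]; ring⟩
      ⟨3 * t, by rw [hd]; ring⟩, residue_fifteen_mul_sqrtNegThree, one_mul]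
  have h0 := residue_ne_zero_of_isCoprime hRp.ne_zero ht
  apply mul_left_cancel₀ h0
  rw [e1, e2, e3]

end Eis

namespace Cyc12

theorem three_dvd_iff (z : Cyc12) : 3 ∣ z ↔ (3 : Eis) ∣ z.re ∧ (3 : Eis) ∣ z.im :=
  QuadraticAlgebra.algebraMap_dvd_iff (r := (3 : Eis))

theorem IsPrimary.re_im {z : Cyc12} (h : IsPrimary z) : Eis.IsPrimary z.re ∧ 3 ∣ z.im := by
  unfold IsPrimary at h
  rw [three_dvd_iff, three_dvd_iff] at h
  simp only [QuadraticAlgebra.re_sub, QuadraticAlgebra.im_sub, QuadraticAlgebra.re_add,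
    QuadraticAlgebra.im_add, QuadraticAlgebra.re_one, QuadraticAlgebra.im_one, sub_zero,
    add_zero] at h
  rcases h with h | h
  · exact ⟨Or.inl h.1, h.2⟩
  · exact ⟨Or.inr h.1, h.2⟩

theorem eps0_sq : ((eps0 ^ 2 : Cyc12ˣ) : Cyc12) = ⟨⟨1, 2⟩, ⟨2, 0⟩⟩ := by
  rw [pow_two]; ext <;> simp [eps0]

theorem I_mul_eps0_pow_six : ((I * eps0 ^ 6 : Cyc12ˣ) : Cyc12) = ⟨26, -(15 * Eis.sqrtNegThree)⟩ := by
  rw [show 6 = 2 * 3 from rfl, pow_mul, pow_succ, pow_two, Units.val_mul, Units.val_mul,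
    Units.val_mul, eps0_sq]
  ext <;> simp [I, Eis.sqrtNegThree, QuadraticAlgebra.re_ofNat, QuadraticAlgebra.im_ofNat]

theorem spin_neg (z : Cyc12) (hz : IsPrimary z) : spin (-z) = spin z := by
  unfold spin
  rw [QuadraticAlgebra.re_neg, QuadraticAlgebra.im_neg, Eis.residue_neg_right,
    Eis.residue_neg_left _ hz.re_im.1.ne_zero]

theorem spin_mul_of_isPrimary {z : Cyc12} (hz : IsPrimary z) :
    spin (((I * eps0 ^ 6 : Cyc12ˣ) : Cyc12) * z) = spin z := by
  rw [I_mul_eps0_pow_six, spin, spin, ← Eis.residue_unit_mul hz.re_im.1 hz.re_im.2]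
  congr 1
  simp
  ring

theorem isPrimary_one : IsPrimary 1 := Or.inl (by simp)

theorem IsPrimary.neg {z : Cyc12} (h : IsPrimary z) : IsPrimary (-z) := by
  rcases h with ⟨c, hc⟩ | ⟨c, hc⟩
  · exact Or.inr ⟨-c, by linear_combination -hc⟩
  · exact Or.inl ⟨-c, by linear_combination -hc⟩

theorem IsPrimary.mul {z w : Cyc12} (hz : IsPrimary z) (hw : IsPrimary w) :
    IsPrimary (z * w) := by
  rcases hz with ⟨c, hc⟩ | ⟨c, hc⟩ <;> rcases hw with ⟨d, hd⟩ | ⟨d, hd⟩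
  · exact Or.inl ⟨c * w + d, by linear_combination w * hc + hd⟩
  · exact Or.inr ⟨c * w + d, by linear_combination w * hc + hd⟩
  · exact Or.inr ⟨c * w - d, by linear_combination w * hc - hd⟩
  · exact Or.inl ⟨c * w - d, by linear_combination w * hc - hd⟩

theorem IsPrimary.of_mul_left {z w : Cyc12} (hz : IsPrimary z) (h : IsPrimary (z * w)) :
    IsPrimary w := by
  rcases hz with ⟨c, hc⟩ | ⟨c, hc⟩ <;> rcases h with ⟨d, hd⟩ | ⟨d, hd⟩
  · exact Or.inl ⟨d - c * w, by linear_combination hd - w * hc⟩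
  · exact Or.inr ⟨d - c * w, by linear_combination hd - w * hc⟩
  · exact Or.inr ⟨c * w - d, by linear_combination w * hc - hd⟩
  · exact Or.inl ⟨c * w - d, by linear_combination w * hc - hd⟩

theorem three_dvd_I_mul_eps0_pow_six : 3 ∣ ((-(I * eps0 ^ 6) : Cyc12ˣ) : Cyc12) - 1 := by
  rw [Units.val_neg, I_mul_eps0_pow_six, three_dvd_iff]
  constructor
  · exact ⟨-9, by simp; norm_num⟩
  · exact ⟨5 * Eis.sqrtNegThree, by simp; ring⟩

theorem isPrimary_I_mul_eps0_pow_six : IsPrimary ((I * eps0 ^ 6 : Cyc12ˣ) : Cyc12) := by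
  have h : IsPrimary ((-(I * eps0 ^ 6) : Cyc12ˣ) : Cyc12) := Or.inl three_dvd_I_mul_eps0_pow_six
  simpa using h.neg

theorem isPrimary_zpow (k : ℤ) : IsPrimary (((I * eps0 ^ 6) ^ k : Cyc12ˣ) : Cyc12) := by
  induction k with
  | zero => simpa using isPrimary_one
  | succ n ih =>
    rw [add_comm, zpow_add, zpow_one, Units.val_mul]
    exact isPrimary_I_mul_eps0_pow_six.mul ih
  | pred n ih =>
    refine isPrimary_I_mul_eps0_pow_six.of_mul_left ?_
    rw [← Units.val_mul, ← zpow_one_add, add_sub_cancel]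
    exact ih

theorem spin_zpow_mul (k : ℤ) {z : Cyc12} (hz : IsPrimary z) :
    spin ((((I * eps0 ^ 6) ^ k : Cyc12ˣ) : Cyc12) * z) = spin z := by
  induction k with
  | zero => simp
  | succ n ih =>
    rw [add_comm, zpow_add, zpow_one, Units.val_mul, mul_assoc,
      spin_mul_of_isPrimary ((isPrimary_zpow _).mul hz), ih]
  | pred n ih =>
    rw [← spin_mul_of_isPrimary ((isPrimary_zpow _).mul hz), ← mul_assoc, ← Units.val_mul,
      ← zpow_one_add, add_sub_cancel, ih]

theorem spin_one : spin 1 = 1 := Eis.residue_unit _ isUnit_one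

end Cyc12

namespace Eis

theorem exists_two_mul_norm_lt {n a b : ℤ} (hn : 0 < n) (ha : 2 * |a| ≤ n) (hb : 2 * |b| ≤ n) :
    ∃ k l : ℤ, 2 * ((a - n * k) ^ 2 - (a - n * k) * (b - n * l) + (b - n * l) ^ 2) < n ^ 2 := by
  have key : ∀ x y : ℤ, 0 ≤ y → y ≤ x → 2 * x ≤ n → n ^ 2 ≤ 2 * (x ^ 2 + x * y + y ^ 2) →
      2 * ((n - x) ^ 2 - (n - x) * y + y ^ 2) < n ^ 2 := by
    intro x y hy hyx hx h
    have h1 : 0 ≤ x * (n - 2 * x) := mul_nonneg (by omega) (by omega)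
    have h2 : 0 ≤ y * (n - 2 * x) := mul_nonneg (by omega) (by omega)
    have h3 : 0 ≤ y * (n - 2 * y) := mul_nonneg (by omega) (by omega)
    have h4 : n ≤ x + 2 * y := le_of_mul_le_mul_left (by nlinarith) hn
    nlinarith
  by_cases h0 : 2 * (a ^ 2 - a * b + b ^ 2) < n ^ 2
  · exact ⟨0, 0, by simpa using h0⟩
  push Not at h0
  rcases abs_cases a with ⟨ea, ha0⟩ | ⟨ea, ha0⟩ <;> rcases abs_cases b with ⟨eb, hb0⟩ | ⟨eb, hb0⟩ <;>
    rw [ea] at ha <;> rw [eb] at hb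
  · exfalso; nlinarith [mul_nonneg ha0 hb0]
  · rcases le_total (-b) a with h | h
    · refine ⟨1, 0, ?_⟩
      have := key a (-b) (by omega) h ha (by linarith)
      linarith
    · refine ⟨0, -1, ?_⟩
      have := key (-b) a (by omega) h hb (by linarith)
      linarith
  · rcases le_total (-a) b with h | h
    · refine ⟨0, 1, ?_⟩
      have := key b (-a) (by omega) h hb (by linarith)
      linarith
    · refine ⟨-1, 0, ?_⟩
      have := key (-a) b (by omega) h ha (by linarith)
      linarith
  · exfalso; nlinarith [mul_pos_of_neg_of_neg ha0 hb0]

/-- Rounding to the hexagonal lattice. -/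
theorem exists_two_mul_norm_sub_lt {n : ℤ} (hn : 0 < n) (z : Eis) :
    ∃ q : Eis, 2 * (z - n * q).norm < n ^ 2 := by
  have key : ∀ m : ℤ, ∃ k : ℤ, 2 * |m - n * k| ≤ n := fun m => by
    refine ⟨(2 * m + n) / (2 * n), ?_⟩
    have h1 := Int.emod_add_mul_ediv (2 * m + n) (2 * n)
    have h2 := Int.emod_nonneg (2 * m + n) (show (2 * n) ≠ 0 by omega)
    have h3 := Int.emod_lt_of_pos (2 * m + n) (show 0 < 2 * n by omega)
    have h4 : ∀ x : ℤ, 2 * |x| = |2 * x| := fun x => by rw [abs_mul, abs_two]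
    rw [h4, abs_le]
    constructor <;> linarith
  obtain ⟨k, hk⟩ := key z.re
  obtain ⟨l, hl⟩ := key z.im
  obtain ⟨k', l', h⟩ := exists_two_mul_norm_lt hn hk hl
  refine ⟨⟨k + k', l + l'⟩, lt_of_eq_of_lt ?_ h⟩
  rw [norm_eq]
  simp
  ring

end Eis

namespace Cyc12

/-- The absolute norm of `ℤ[ζ₁₂]`. -/
noncomputable def absNorm : Cyc12 →* ℤ :=
  (QuadraticAlgebra.norm : Eis →* ℤ).comp QuadraticAlgebra.norm

/-- `N r + N s` for `z = r + i s`, half of the trace of `z z̄`. -/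
def size (z : Cyc12) : ℤ := z.re.norm + z.im.norm

theorem absNorm_eq (z : Cyc12) :
    absNorm z = z.size ^ 2 - 3 * (z.re.re * z.im.im - z.re.im * z.im.re) ^ 2 := by
  change (QuadraticAlgebra.norm z).norm = _
  rw [Eis.norm_eq, QuadraticAlgebra.norm_def, size, Eis.norm_eq, Eis.norm_eq]
  simp
  ring

theorem size_nonneg (z : Cyc12) : 0 ≤ z.size :=
  add_nonneg (Eis.norm_nonneg _) (Eis.norm_nonneg _)

theorem size_eq_zero {z : Cyc12} (h : z.size = 0) : z = 0 := by
  have h1 := Eis.norm_nonneg z.re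
  have h2 := Eis.norm_nonneg z.im
  unfold size at h
  have h3 := (Eis.norm_eq_zero_iff z.re).1 (by omega)
  have h4 := (Eis.norm_eq_zero_iff z.im).1 (by omega)
  ext <;> simp [h3, h4]

theorem absNorm_nonneg (z : Cyc12) : 0 ≤ absNorm z := Eis.norm_nonneg _

theorem absNorm_eq_zero_iff (z : Cyc12) : absNorm z = 0 ↔ z = 0 := by
  constructor
  · intro h
    rw [absNorm_eq, sub_eq_zero] at h
    apply size_eq_zero
    have h3 : Zsqrtd.Nonsquare 3 := ⟨fun n hn => by
      have : n < 2 := by nlinarith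
      interval_cases n <;> omega⟩
    exact (Zsqrtd.divides_sq_eq_zero_z (d := 3) (y := z.re.re * z.im.im - z.re.im * z.im.re)
      (by push_cast; linear_combination h)).1
  · rintro rfl
    simp [absNorm]

theorem absNorm_pos {z : Cyc12} (h : z ≠ 0) : 0 < absNorm z :=
  lt_of_le_of_ne (absNorm_nonneg z) fun h' => h ((absNorm_eq_zero_iff z).1 h'.symm)

theorem absNorm_intCast (n : ℤ) : absNorm (n : Cyc12) = n ^ 4 := by
  change (QuadraticAlgebra.norm (n : Cyc12)).norm = _
  rw [QuadraticAlgebra.norm_intCast, map_pow, QuadraticAlgebra.norm_intCast, Int.cast_id]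
  ring

theorem exists_mul_eq_absNorm (z : Cyc12) : ∃ w : Cyc12, z * w = (absNorm z : Cyc12) := by
  refine ⟨star z * algebraMap Eis Cyc12 (star (QuadraticAlgebra.norm z)), ?_⟩
  rw [← mul_assoc, ← QuadraticAlgebra.algebraMap_norm_eq_mul_star, ← map_mul, Eis.mul_star_self,
    map_intCast]
  rfl

instance : IsDomain Cyc12 :=
  haveI : NoZeroDivisors Cyc12 := ⟨fun {a b} h => by
    have h1 : absNorm a * absNorm b = 0 := by
      rw [← map_mul, h]
      exact (absNorm_eq_zero_iff 0).2 rfl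
    rcases mul_eq_zero.1 h1 with h2 | h2
    · exact Or.inl ((absNorm_eq_zero_iff a).1 h2)
    · exact Or.inr ((absNorm_eq_zero_iff b).1 h2)⟩
  NoZeroDivisors.to_isDomain _

/-- `ℤ[ζ₁₂]` is norm-Euclidean. -/
theorem exists_absNorm_sub_mul_lt (w v : Cyc12) (hv : v ≠ 0) :
    ∃ q : Cyc12, absNorm (w - v * q) < absNorm v := by
  have hn := absNorm_pos hv
  obtain ⟨v', hv'⟩ := exists_mul_eq_absNorm v
  have hN := congrArg absNorm hv'
  rw [map_mul, absNorm_intCast] at hN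
  set n := absNorm v with hn'
  have hN' : absNorm v' = n ^ 3 := mul_left_cancel₀ hn.ne' (by rw [hN]; ring)
  obtain ⟨q₁, h₁⟩ := Eis.exists_two_mul_norm_sub_lt hn (w * v').re
  obtain ⟨q₂, h₂⟩ := Eis.exists_two_mul_norm_sub_lt hn (w * v').im
  refine ⟨⟨q₁, q₂⟩, ?_⟩
  have e : (w - v * ⟨q₁, q₂⟩) * v' = w * v' - n * ⟨q₁, q₂⟩ := by
    rw [← hv']; ring
  have hs : (w * v' - n * ⟨q₁, q₂⟩ : Cyc12).size < n ^ 2 := by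
    have e1 : (w * v' - n * ⟨q₁, q₂⟩ : Cyc12).re = (w * v').re - n * q₁ := by
      simp
    have e2 : (w * v' - n * ⟨q₁, q₂⟩ : Cyc12).im = (w * v').im - n * q₂ := by
      simp
    rw [size, e1, e2]
    linarith
  have h0 := size_nonneg (w * v' - n * ⟨q₁, q₂⟩ : Cyc12)
  have h1 : absNorm (w * v' - n * ⟨q₁, q₂⟩ : Cyc12) < n ^ 4 := by
    rw [absNorm_eq]
    nlinarith [sq_nonneg ((w * v' - n * ⟨q₁, q₂⟩ : Cyc12).re.re * (w * v' - n * ⟨q₁, q₂⟩ : Cyc12).im.im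
      - (w * v' - n * ⟨q₁, q₂⟩ : Cyc12).re.im * (w * v' - n * ⟨q₁, q₂⟩ : Cyc12).im.re)]
  rw [← e, map_mul, hN'] at h1
  have h3 : 0 < n ^ 3 := by positivity
  exact lt_of_mul_lt_mul_right (by linarith [h1]) h3.le

instance : IsPrincipalIdealRing Cyc12 := ⟨fun I => by
  by_cases hI : I = ⊥
  · subst hI; infer_instance
  obtain ⟨y₀, hy₀, hy₀'⟩ := (Submodule.ne_bot_iff I).1 hI
  obtain ⟨y, ⟨hyI, hy0⟩, hmin⟩ := WellFounded.has_min
    (measure fun z : Cyc12 => (absNorm z).toNat).wf {z | z ∈ I ∧ z ≠ 0} ⟨y₀, hy₀, hy₀'⟩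
  refine ⟨⟨y, le_antisymm (fun x hx => ?_) ?_⟩⟩
  · obtain ⟨q, hq⟩ := exists_absNorm_sub_mul_lt x y hy0
    have hmem : x - y * q ∈ I := I.sub_mem hx (I.mul_mem_right q hyI)
    have h0 : x - y * q = 0 := by
      by_contra h
      refine hmin _ ⟨hmem, h⟩ ?_
      change (absNorm (x - y * q)).toNat < (absNorm y).toNat
      have := absNorm_nonneg (x - y * q)
      omega
    exact Ideal.mem_span_singleton'.2 ⟨q, by rw [mul_comm]; exact (sub_eq_zero.1 h0).symm⟩
  · exact (Ideal.span_singleton_le_iff_mem I).2 hyI⟩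

/-! ### The unit group -/

theorem absNorm_units (u : Cyc12ˣ) : absNorm u = 1 := by
  have h : IsUnit (absNorm (u : Cyc12)) := u.isUnit.map absNorm
  have := absNorm_nonneg u
  rw [Int.isUnit_iff] at h
  omega

theorem size_eps0_mul (z : Cyc12) :
    size (eps0 * z) = 2 * z.size - 3 * (z.re.re * z.im.im - z.re.im * z.im.re) := by
  simp only [size, Eis.norm_eq]
  simp [eps0]
  ring

theorem size_eps0_inv_mul (z : Cyc12) :
    size ((eps0⁻¹ : Cyc12ˣ) * z) = 2 * z.size + 3 * (z.re.re * z.im.im - z.re.im * z.im.re) := by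
  simp only [size, Eis.norm_eq]
  simp [eps0]
  ring

theorem zeta12_pow_three : zeta12 ^ 3 = I := by
  rw [pow_succ, pow_two]; ext <;> simp [zeta12, I]

theorem zeta12_pow_four : ((zeta12 ^ 4 : Cyc12ˣ) : Cyc12) = algebraMap Eis Cyc12 Eis.zeta3 := by
  rw [show 4 = 2 * 2 from rfl, pow_mul, pow_two, pow_two]; ext <;> simp [zeta12, Eis.zeta3]

theorem zeta12_pow_six : zeta12 ^ 6 = -1 := by
  rw [show 6 = 3 * 2 from rfl, pow_mul, zeta12_pow_three, pow_two]; ext <;> simp [I]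

theorem exists_zeta12_pow_of_isUnit {r : Eis} (hr : IsUnit r) :
    ∃ l : ℕ, ((zeta12 ^ l : Cyc12ˣ) : Cyc12) = algebraMap Eis Cyc12 r := by
  have hl : ¬ Eis.lam ∣ r := fun h => Eis.prime_lam.not_isUnit (isUnit_of_dvd_unit h hr)
  obtain ⟨k, hk⟩ := Eis.exists_pow_mul_isPrimary hl
  rw [Eis.eq_zeta3_pow_mul k r]
  rcases Eis.eq_one_or_neg_one_of_isPrimary ((Eis.isUnit_zeta3.pow k).mul hr) hk with h | h
  · refine ⟨4 * (2 * k), ?_⟩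
    rw [h, mul_one, pow_mul, Units.val_pow_eq_pow_val, zeta12_pow_four, map_pow]
  · refine ⟨4 * (2 * k) + 6, ?_⟩
    rw [h, pow_add, pow_mul, zeta12_pow_six, Units.val_mul, Units.val_pow_eq_pow_val,
      zeta12_pow_four, map_mul, map_pow]
    simp

theorem exists_zeta12_pow_of_size_eq_one {u : Cyc12ˣ} (h : size (u : Cyc12) = 1) :
    ∃ l : ℕ, u = zeta12 ^ l := by
  have h1 := Eis.norm_nonneg (u : Cyc12).re
  have h2 := Eis.norm_nonneg (u : Cyc12).im
  rw [size] at h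
  obtain h3 | h3 : (u : Cyc12).re.norm = 0 ∨ (u : Cyc12).im.norm = 0 := by omega
  · obtain ⟨l, hl⟩ := exists_zeta12_pow_of_isUnit ((Eis.isUnit_iff_norm (u : Cyc12).im).2 (by omega))
    refine ⟨l + 3, Units.ext ?_⟩
    rw [pow_add, Units.val_mul, hl, zeta12_pow_three]
    rw [Eis.norm_eq_zero_iff] at h3
    refine QuadraticAlgebra.ext ?_ ?_
    · rw [h3]; simp [I]
    · simp [I]
  · obtain ⟨l, hl⟩ := exists_zeta12_pow_of_isUnit ((Eis.isUnit_iff_norm (u : Cyc12).re).2 (by omega))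
    refine ⟨l, Units.ext ?_⟩
    rw [hl]
    rw [Eis.norm_eq_zero_iff] at h3
    refine QuadraticAlgebra.ext ?_ ?_
    · simp
    · rw [h3]; simp

/-- The units of `ℤ[ζ₁₂]` are the products of powers of `ζ₁₂` and `ε₀`. -/
theorem exists_eq_zeta12_zpow_mul_eps0_zpow (u : Cyc12ˣ) :
    ∃ l k : ℤ, u = zeta12 ^ l * eps0 ^ k := by
  induction hm : (size (u : Cyc12)).toNat using Nat.strong_induction_on generalizing u with
  | _ m ih =>
    have h0 := size_nonneg (u : Cyc12)
    have hN := absNorm_units u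
    rw [absNorm_eq] at hN
    by_cases h1 : size (u : Cyc12) = 1
    · obtain ⟨l, hl⟩ := exists_zeta12_pow_of_size_eq_one h1
      exact ⟨l, 0, by rw [hl]; simp⟩
    have h2 : size (u : Cyc12) ≠ 0 := fun h => u.ne_zero (size_eq_zero h)
    have h3 := size_eps0_mul u
    have h4 := size_eps0_inv_mul u
    have h5 := size_nonneg (eps0 * u)
    have h6 := size_nonneg ((eps0⁻¹ : Cyc12ˣ) * u)
    generalize (u : Cyc12).re.re * (u : Cyc12).im.im - (u : Cyc12).re.im * (u : Cyc12).im.re = y at *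
    have h7 : 2 ≤ size (u : Cyc12) := by omega
    rcases le_total y 0 with hy | hy
    · have h8 : size (u : Cyc12) < -(3 * y) := by
        by_contra h
        nlinarith
      obtain ⟨l, k, h⟩ := ih _ (by rw [Units.val_mul]; omega) (eps0⁻¹ * u) rfl
      refine ⟨l, k + 1, ?_⟩
      rw [inv_mul_eq_iff_eq_mul] at h
      rw [h, zpow_add, zpow_one, mul_comm, mul_assoc]
    · have h8 : size (u : Cyc12) < 3 * y := by
        by_contra h
        nlinarith
      obtain ⟨l, k, h⟩ := ih _ (by rw [Units.val_mul]; omega) (eps0 * u) rfl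
      refine ⟨l, k - 1, ?_⟩
      rw [zpow_sub, zpow_one, ← mul_assoc, ← h]
      simp

end Cyc12

namespace Cyc12

theorem three_dvd_iff_int (z : Cyc12) : 3 ∣ z ↔
    ((3 : ℤ) ∣ z.re.re ∧ (3 : ℤ) ∣ z.re.im) ∧ ((3 : ℤ) ∣ z.im.re ∧ (3 : ℤ) ∣ z.im.im) := by
  rw [three_dvd_iff, Eis.ofNat_dvd_iff, Eis.ofNat_dvd_iff]

instance decidableThreeDvd (z : Cyc12) : Decidable (3 ∣ z) :=
  decidable_of_iff' _ (three_dvd_iff_int z)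

theorem not_three_dvd_eps0_pow_sub_zeta12_pow : ∀ k : Fin 5, ∀ l : Fin 12,
    ¬ (3 : Cyc12) ∣ (eps0 : Cyc12) ^ (k + 1 : ℕ) - (zeta12 : Cyc12) ^ (l : ℕ) := by
  decide

theorem zeta12_pow_ne : ∀ l : Fin 12, (l : ℕ) ≠ 0 → (l : ℕ) ≠ 6 →
    ¬ (3 : Cyc12) ∣ (zeta12 : Cyc12) ^ (l : ℕ) - 1 ∧ ¬ (3 : Cyc12) ∣ (zeta12 : Cyc12) ^ (l : ℕ) + 1 := by
  decide

theorem exists_three_dvd_sub_or_sq : ∀ a b c d : Fin 3,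
    (∃ l : Fin 12, ∃ k : Fin 6, (3 : Cyc12) ∣ ⟨⟨(a : ℕ), (b : ℕ)⟩, ⟨(c : ℕ), (d : ℕ)⟩⟩ -
      (zeta12 : Cyc12) ^ (l : ℕ) * (eps0 : Cyc12) ^ (k : ℕ)) ∨
    (3 : Cyc12) ∣ ⟨⟨(a : ℕ), (b : ℕ)⟩, ⟨(c : ℕ), (d : ℕ)⟩⟩ ^ 2 := by
  decide +kernel

end Cyc12

namespace Cyc12

theorem zeta12_zpow_eq_pow (l : ℤ) : ∃ m : Fin 12, zeta12 ^ l = zeta12 ^ (m : ℕ) := by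
  have h12 : zeta12 ^ (12 : ℤ) = 1 := by
    rw [show (12 : ℤ) = (12 : ℕ) from rfl, zpow_natCast]; exact zeta12_primitive.pow_eq_one
  refine ⟨⟨(l % 12).toNat, by omega⟩, ?_⟩
  rw [← zpow_natCast]
  have h : (((l % 12).toNat : ℕ) : ℤ) = l % 12 := by omega
  conv_lhs => rw [← Int.emod_add_mul_ediv l 12, zpow_add, zpow_mul, h12, one_zpow, mul_one]
  rw [h]

theorem exists_three_dvd_sub (z : Cyc12) (hz : ¬ 3 ∣ z ^ 2) :
    ∃ l k : ℕ, k ≤ 5 ∧ 3 ∣ z - ((zeta12 ^ l * eps0 ^ k : Cyc12ˣ) : Cyc12) := by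
  have key : ∀ n : ℤ, ∃ a : Fin 3, (3 : ℤ) ∣ n - (a : ℕ) := fun n =>
    ⟨⟨(n % 3).toNat, by omega⟩, by simp only; omega⟩
  obtain ⟨a, ha⟩ := key z.re.re
  obtain ⟨b, hb⟩ := key z.re.im
  obtain ⟨c, hc⟩ := key z.im.re
  obtain ⟨d, hd⟩ := key z.im.im
  set w : Cyc12 := ⟨⟨(a : ℕ), (b : ℕ)⟩, ⟨(c : ℕ), (d : ℕ)⟩⟩ with hw
  have hzw : 3 ∣ z - w := by
    rw [three_dvd_iff_int]
    exact ⟨⟨ha, hb⟩, hc, hd⟩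
  rcases exists_three_dvd_sub_or_sq a b c d with ⟨l, k, h⟩ | h
  · refine ⟨l, k, by omega, ?_⟩
    push_cast
    have := dvd_add hzw h
    rwa [sub_add_sub_cancel] at this
  · refine absurd ?_ hz
    have := dvd_add (hzw.trans (sub_dvd_pow_sub_pow z w 2)) h
    rwa [sub_add_cancel] at this

theorem not_three_dvd_one : ¬ (3 : Cyc12) ∣ 1 := by decide

theorem not_three_dvd_sq {z a b : Cyc12} (h : a * z + b * 3 = 1) : ¬ 3 ∣ z ^ 2 := by
  rintro ⟨c, hc⟩
  exact not_three_dvd_one ⟨a ^ 2 * c + 2 * b * (a * z) + 3 * b ^ 2, by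
    linear_combination a ^ 2 * hc - (a * z + b * 3 + 1) * h⟩

theorem isLeast_six : IsLeast {k : ℕ | 0 < k ∧ ∃ l : ℤ,
    (3 : Cyc12) ∣ ((eps0 ^ k : Cyc12ˣ) : Cyc12) - ((zeta12 ^ l : Cyc12ˣ) : Cyc12)} 6 := by
  constructor
  · refine ⟨by norm_num, 3, ?_⟩
    rw [show (3 : ℤ) = (3 : ℕ) from rfl, zpow_natCast, zeta12_pow_three]
    obtain ⟨c, hc⟩ := three_dvd_I_mul_eps0_pow_six
    refine ⟨I * c, ?_⟩
    have hI : (I : Cyc12) * I = -1 := by ext <;> simp [I]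
    rw [Units.val_neg, Units.val_mul] at hc
    linear_combination (I : Cyc12) * hc + ((eps0 ^ 6 : Cyc12ˣ) : Cyc12) * hI
  · rintro k ⟨hk, l, h⟩
    by_contra hk6
    obtain ⟨m, hm⟩ := zeta12_zpow_eq_pow l
    rw [hm, Units.val_pow_eq_pow_val, Units.val_pow_eq_pow_val] at h
    have := not_three_dvd_eps0_pow_sub_zeta12_pow ⟨k - 1, by omega⟩ m
    simp only [Nat.sub_add_cancel hk] at this
    exact this h

theorem setOf_isUnit_eq : {x : Cyc12 ⧸ Ideal.span {(3 : Cyc12)} | IsUnit x} =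
    {x | ∃ l : ℤ, ∃ k : ℕ, k ≤ 5 ∧ x = Ideal.Quotient.mk (Ideal.span {(3 : Cyc12)})
      ((zeta12 ^ l * eps0 ^ k : Cyc12ˣ) : Cyc12)} := by
  ext x
  simp only [Set.mem_ofPred_eq]
  constructor
  · intro hx
    obtain ⟨y, hy⟩ := hx.exists_left_inv
    obtain ⟨z, rfl⟩ := Ideal.Quotient.mk_surjective x
    obtain ⟨w, rfl⟩ := Ideal.Quotient.mk_surjective y
    rw [← map_mul, ← map_one (Ideal.Quotient.mk _), Ideal.Quotient.mk_eq_mk_iff_sub_mem,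
      Ideal.mem_span_singleton] at hy
    obtain ⟨c, hc⟩ := hy
    obtain ⟨l, k, hk, h⟩ := exists_three_dvd_sub z
      (not_three_dvd_sq (a := w) (b := -c) (by linear_combination hc))
    refine ⟨l, k, hk, ?_⟩
    rwa [Ideal.Quotient.mk_eq_mk_iff_sub_mem, Ideal.mem_span_singleton, zpow_natCast]
  · rintro ⟨l, k, -, rfl⟩
    exact (Units.isUnit _).map _

theorem isPrimary_units_iff (u : Cyc12ˣ) : IsPrimary (u : Cyc12) ↔
    ∃ k : ℤ, u = (I * eps0 ^ 6) ^ k ∨ u = -(I * eps0 ^ 6) ^ k := by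
  constructor
  · intro hu
    obtain ⟨l, k, rfl⟩ := exists_eq_zeta12_zpow_mul_eps0_zpow u
    obtain ⟨j, hj⟩ : ∃ j : ℕ, k % 6 = j := ⟨(k % 6).toNat, by omega⟩
    have e : zeta12 ^ l * eps0 ^ k =
        (I * eps0 ^ 6) ^ (k / 6) * (zeta12 ^ (l - 3 * (k / 6)) * eps0 ^ j) := by
      have e1 : eps0 ^ k = (eps0 ^ 6) ^ (k / 6) * eps0 ^ j := by
        conv_lhs => rw [← Int.mul_ediv_add_emod k 6, hj, zpow_add, zpow_mul, zpow_natCast]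
        rfl
      have e2 : zeta12 ^ l = I ^ (k / 6) * zeta12 ^ (l - 3 * (k / 6)) := by
        rw [← zeta12_pow_three, ← zpow_natCast, ← zpow_mul, ← zpow_add]
        congr 1
        push_cast
        ring
      rw [e1, e2, mul_zpow]
      exact mul_mul_mul_comm _ _ _ _
    rw [e, Units.val_mul] at hu
    have hv := (isPrimary_zpow _).of_mul_left hu
    have hj0 : j = 0 := by
      by_contra h0
      have hmem : 6 ≤ j := by
        refine isLeast_six.2 ⟨Nat.pos_of_ne_zero h0, ?_⟩
        have hc : ((zeta12 ^ (-(l - 3 * (k / 6))) : Cyc12ˣ) : Cyc12) *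
            ((zeta12 ^ (l - 3 * (k / 6)) : Cyc12ˣ) : Cyc12) = 1 := by
          rw [← Units.val_mul, ← zpow_add, neg_add_cancel, zpow_zero, Units.val_one]
        rw [Units.val_mul] at hv
        rcases hv with ⟨c, hc'⟩ | ⟨c, hc'⟩
        · refine ⟨-(l - 3 * (k / 6)), ((zeta12 ^ (-(l - 3 * (k / 6))) : Cyc12ˣ) : Cyc12) * c, ?_⟩
          linear_combination ((zeta12 ^ (-(l - 3 * (k / 6))) : Cyc12ˣ) : Cyc12) * hc' -
            ((eps0 ^ j : Cyc12ˣ) : Cyc12) * hc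
        · refine ⟨-(l - 3 * (k / 6)) + (6 : ℕ),
            ((zeta12 ^ (-(l - 3 * (k / 6))) : Cyc12ˣ) : Cyc12) * c, ?_⟩
          rw [zpow_add, zpow_natCast, zeta12_pow_six, Units.val_mul, Units.val_neg, Units.val_one]
          linear_combination ((zeta12 ^ (-(l - 3 * (k / 6))) : Cyc12ˣ) : Cyc12) * hc' -
            ((eps0 ^ j : Cyc12ˣ) : Cyc12) * hc
      omega
    subst hj0
    rw [e]
    rw [pow_zero, mul_one] at hv ⊢
    obtain ⟨m, hm⟩ := zeta12_zpow_eq_pow (l - 3 * (k / 6))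
    rw [hm] at hv ⊢
    have hm' : (m : ℕ) = 0 ∨ (m : ℕ) = 6 := by
      by_contra h
      push Not at h
      have h2 := zeta12_pow_ne m h.1 h.2
      rw [IsPrimary, Units.val_pow_eq_pow_val] at hv
      exact hv.elim h2.1 h2.2
    refine ⟨k / 6, ?_⟩
    rcases hm' with h | h
    · left; rw [h, pow_zero, mul_one]
    · right; rw [h, zeta12_pow_six, mul_neg, mul_one]
  · rintro ⟨k, rfl | rfl⟩
    · exact isPrimary_zpow k
    · rw [Units.val_neg]; exact (isPrimary_zpow k).neg

theorem spin_eq_of_associated {z z' : Cyc12} (hz : IsPrimary z) (hz' : IsPrimary z')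
    (h : Associated z z') : spin z = spin z' := by
  obtain ⟨u, rfl⟩ := h
  obtain ⟨k, rfl | rfl⟩ := (isPrimary_units_iff u).1 (hz.of_mul_left hz')
  · rw [mul_comm, spin_zpow_mul k hz]
  · rw [Units.val_neg, mul_neg, mul_comm, spin_neg _ ((isPrimary_zpow k).mul hz),
      spin_zpow_mul k hz]

theorem isCoprime_span_three_iff (a : Ideal Cyc12) : IsCoprime a (Ideal.span {3}) ↔
    ∃ z : Cyc12, IsPrimary z ∧ a = Ideal.span {z} := by
  constructor
  · intro h
    obtain ⟨z, rfl⟩ := IsPrincipalIdealRing.principal a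
    change IsCoprime (Ideal.span {z}) _ at h
    rw [Ideal.isCoprime_span_singleton_iff] at h
    obtain ⟨x, y, hxy⟩ := h
    obtain ⟨l, k, -, c, hc⟩ := exists_three_dvd_sub z (not_three_dvd_sq hxy)
    set u : Cyc12ˣ := zeta12 ^ l * eps0 ^ k
    refine ⟨z * (u⁻¹ : Cyc12ˣ), Or.inl ⟨c * (u⁻¹ : Cyc12ˣ), ?_⟩, ?_⟩
    · linear_combination (u⁻¹ : Cyc12ˣ) * hc + Units.mul_inv u
    · exact Ideal.span_singleton_eq_span_singleton.2 ⟨u⁻¹, rfl⟩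
  · rintro ⟨z, ⟨c, hc⟩ | ⟨c, hc⟩, rfl⟩
    · rw [Ideal.isCoprime_span_singleton_iff]
      exact ⟨1, -c, by linear_combination hc⟩
    · rw [Ideal.isCoprime_span_singleton_iff]
      exact ⟨-1, c, by linear_combination -hc⟩

theorem spin_eq_zero_of_not_isPrimitive {z : Cyc12} (hz : IsPrimary z) (h : ¬ IsPrimitive z) :
    spin z = 0 := by
  have hr := hz.re_im.1
  rw [spin, Eis.residue_eq_zero_iff _ hr.ne_zero]
  by_contra hc
  push Not at hc
  refine h (isCoprime_of_prime_dvd (fun h' => hr.ne_zero h'.1) fun p hp hpr hps => ?_)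
  refine hc p hp (fun h3 => hr.not_lam_dvd ?_) hpr hps
  exact ((Eis.dvd_three_iff_lam_dvd hp).1 h3).trans hpr

open Classical in
theorem existsUnique_spin_ideal : ∃! f : Ideal Cyc12 → Eis,
    (∀ z : Cyc12, IsPrimary z → f (Ideal.span {z}) = spin z) ∧
    (∀ a : Ideal Cyc12,
      (¬ ∃ z : Cyc12, IsPrimary z ∧ IsPrimitive z ∧ a = Ideal.span {z}) → f a = 0) := by
  refine ⟨fun a => if h : ∃ z, IsPrimary z ∧ a = Ideal.span {z} then spin h.choose else 0,
    ⟨fun z hz => ?_, fun a ha => ?_⟩, fun g hg => funext fun a => ?_⟩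
  · have h : ∃ w, IsPrimary w ∧ Ideal.span {z} = Ideal.span {w} := ⟨z, hz, rfl⟩
    simp only [dif_pos h]
    exact spin_eq_of_associated h.choose_spec.1 hz
      (Ideal.span_singleton_eq_span_singleton.1 h.choose_spec.2.symm)
  · by_cases h : ∃ z, IsPrimary z ∧ a = Ideal.span {z}
    · simp only [dif_pos h]
      exact spin_eq_zero_of_not_isPrimitive h.choose_spec.1 fun h' =>
        ha ⟨_, h.choose_spec.1, h', h.choose_spec.2⟩
    · simp only [dif_neg h]
  · by_cases h : ∃ z, IsPrimary z ∧ a = Ideal.span {z}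
    · simp only [dif_pos h]
      conv_lhs => rw [h.choose_spec.2]
      exact hg.1 _ h.choose_spec.1
    · simp only [dif_neg h]
      exact hg.2 a fun ⟨z, hz, _, ha⟩ => h ⟨z, hz, ha⟩

theorem spin_I_mul_eps0_pow_six : spin ((I * eps0 ^ 6 : Cyc12ˣ) : Cyc12) = 1 := by
  rw [← mul_one ((I * eps0 ^ 6 : Cyc12ˣ) : Cyc12), spin_mul_of_isPrimary isPrimary_one, spin_one]

end Cyc12

end CubicSpin

open CubicSpin CubicSpin.Cyc12 in
theorem mainTheorem5 :
    -- `-i ε₀⁶ ≡ 1 (mod 3)`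
    ((3 : Cyc12) ∣ ((-(I * eps0 ^ 6) : Cyc12ˣ) : Cyc12) - 1) ∧
    -- `6` is the least positive `k` such that `ε₀ᵏ` is congruent to a power of `ζ₁₂` modulo `3`
    IsLeast {k : ℕ | 0 < k ∧ ∃ l : ℤ,
      (3 : Cyc12) ∣ ((eps0 ^ k : Cyc12ˣ) : Cyc12) - ((zeta12 ^ l : Cyc12ˣ) : Cyc12)} 6 ∧
    -- the unit group of `ℤ[ζ₁₂] / 3 ℤ[ζ₁₂]`, as a set
    {x : Cyc12 ⧸ Ideal.span {(3 : Cyc12)} | IsUnit x} =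
      {x | ∃ l : ℤ, ∃ k : ℕ, k ≤ 5 ∧
        x = Ideal.Quotient.mk (Ideal.span {(3 : Cyc12)}) ((zeta12 ^ l * eps0 ^ k : Cyc12ˣ) : Cyc12)} ∧
    -- the primary units
    {u : Cyc12ˣ | IsPrimary u} =
      {u | ∃ k : ℤ, u = (I * eps0 ^ 6) ^ k ∨ u = -(I * eps0 ^ 6) ^ k} ∧
    -- `[± i ε₀⁶] = 1`
    spin ((I * eps0 ^ 6 : Cyc12ˣ) : Cyc12) = 1 ∧
    spin ((-(I * eps0 ^ 6) : Cyc12ˣ) : Cyc12) = 1 ∧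
    -- primary associates have the same spin
    (∀ z z' : Cyc12, IsPrimary z → IsPrimary z' → Associated z z' → spin z = spin z') ∧
    -- the ideals with a primary generator are exactly the ideals coprime to `3`
    (∀ a : Ideal Cyc12, IsCoprime a (Ideal.span {3}) ↔
      ∃ z : Cyc12, IsPrimary z ∧ a = Ideal.span {z}) ∧
    -- the spin is well defined on ideals: `[a] = [z]` for every primary generator `z` of `a`, and
    -- `[a] = 0` if `a` has no primary generator `z = r + i s` with `(r, s) = 1`
    (∃! f : Ideal Cyc12 → Eis,
      (∀ z : Cyc12, IsPrimary z → f (Ideal.span {z}) = spin z) ∧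
      (∀ a : Ideal Cyc12,
        (¬ ∃ z : Cyc12, IsPrimary z ∧ IsPrimitive z ∧ a = Ideal.span {z}) → f a = 0)) := by
  refine ⟨three_dvd_I_mul_eps0_pow_six, isLeast_six, setOf_isUnit_eq,
    Set.ext isPrimary_units_iff, spin_I_mul_eps0_pow_six, ?_,
    fun z z' => spin_eq_of_associated, isCoprime_span_three_iff, existsUnique_spin_ideal⟩
  rw [Units.val_neg, spin_neg _ isPrimary_I_mul_eps0_pow_six, spin_I_mul_eps0_pow_six]
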